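/- Let $n\ge 2$ be an integer, let $1<p<\infty$, let $c\in\mathbb R$, and let $M^n(c)$ be the simply connected space form of dimension $n$ and constant sectional curvature $c$: the hyperbolic space if $c<0$, $\mathbb R^n$ if $c=0$, and the round sphere of radius $1/\sqrt c$ if $c>0$. For a bounded domain (nonempty connected open set) $\Omega\subset M^n(c)$ let $$\lambda_{1,p}(\Omega)=\inf\left\{\frac{\int_\Omega\|\nabla u\|^p\,dM}{\int_\Omega|u|^p\,dM}\;:\;u\in W^{1,p}_0(\Omega),\ u\neq 0\right\}$$ be the first Dirichlet eigenvalue of the $p$-Laplacian, where $dM$ is the Riemannian volume and $W^{1,p}_0(\Omega)$ is the closure of $C^\infty_0(\Omega)$ in $W^{1,p}(\Omega)$. Suppose that $\Omega$ is contained in an open geodesic ball $B_R$ of radius $R>0$ (with arbitrary center), where in the case $c>0$ it is assumed that $R\le \frac{\pi}{2\sqrt c}$. Then $$\lambda_{1,p}(\Omega)\ \ge\ \begin{cases}\dfrac{(n-1)^p(\sqrt{-c})^p}{p^p}\,\coth^p(\sqrt{-c}\,R), & c<0,\\[2mm] \dfrac{(n-1)^p}{p^p\,R^p}, & c=0,\\[2mm]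 \dfrac{(n-1)^p(\sqrt c)^p}{p^p}\,\cot^p(\sqrt c\,R), & c>0.\end{cases}$$ -/

import Mathlib

open Set Filter Topology MeasureTheory Manifold Bundle Bornology
open scoped ENNReal ContDiff

noncomputable section

namespace SpaceForm

/-! ### The first `p`-eigenvalue of a domain in a Riemannian manifold -/

section General

variable {n : ℕ} {M : Type*} [TopologicalSpace M] [ChartedSpace (EuclideanSpace ℝ (Fin n)) M]

/-- The open geodesic ball `B_R(q)`: the points at Riemannian distance less than `R` from `q`, the
distance being the infimum of the `g`-lengths of `C^1` paths. -/
def geodesicBall (g : RiemannianMetric (fun x : M => TangentSpace (𝓡 n) x)) (q : M) (R : ℝ) :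
    Set M :=
  letI : RiemannianBundle (fun x : M => TangentSpace (𝓡 n) x) := ⟨g⟩
  {x | riemannianEDist (𝓡 n) q x < ENNReal.ofReal R}

/-- The norm of a covector `α` at `x` with respect to `g`. For `α = du` it is the `g`-norm of the
gradient of `u`, because `α` is identified with a tangent vector through `g`. -/
def conorm (g : RiemannianMetric (fun x : M => TangentSpace (𝓡 n) x)) (x : M)
    (α : TangentSpace (𝓡 n) x →L[ℝ] ℝ) : ℝ≥0∞ :=
  ⨆ (v : TangentSpace (𝓡 n) x) (_ : g.inner x v v ≤ 1), ENNReal.ofReal (α v)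

/-- `φ ∈ C_0^∞(Ω)`: a smooth real function with compact support contained in `Ω`. -/
structure IsTestFunction (Ω : Set M) (φ : M → ℝ) : Prop where
  contMDiff : ContMDiff (𝓡 n) 𝓘(ℝ, ℝ) ∞ φ
  compact : HasCompactSupport φ
  subset : tsupport φ ⊆ Ω

variable [MeasurableSpace M]

/-- `u ∈ W_0^{1,p}(Ω)` with differential `V = du`: the pair `(u, V)` lies in the closure, for the
norm of `W^{1,p}`, of the pairs `(φ, dφ)` with `φ ∈ C_0^∞(Ω)`. Here `g` is the metric and `μ` its
volume measure. Only the values on `Ω` of `u` and `V` matter.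

The field `aemeasurable` says that the section `V` of the cotangent bundle is measurable: by
polarization it means that the `g`-products of `V` with `V` and with all `dφ` are measurable, and
near each point finitely many such `dφ` form a frame of the cotangent bundle. -/
structure IsW0 (g : RiemannianMetric (fun x : M => TangentSpace (𝓡 n) x)) (μ : Measure M)
    (p : ℝ) (Ω : Set M) (u : M → ℝ) (V : ∀ x : M, TangentSpace (𝓡 n) x →L[ℝ] ℝ) : Prop where
  memLp : MemLp u (ENNReal.ofReal p) (μ.restrict Ω)
  aemeasurable : ∀ φ : M → ℝ, IsTestFunction (n := n) univ φ →
    AEMeasurable (fun x => conorm g x (V x - mvfderiv (𝓡 n) φ x)) (μ.restrict Ω)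
  lintegral_lt_top : ∫⁻ x in Ω, conorm g x (V x) ^ p ∂μ < ⊤
  exists_seq : ∃ φ : ℕ → M → ℝ, (∀ k, IsTestFunction (n := n) Ω (φ k)) ∧
    Tendsto (fun k => ∫⁻ x in Ω, ‖u x - φ k x‖ₑ ^ p ∂μ) atTop (𝓝 0) ∧
    Tendsto (fun k => ∫⁻ x in Ω, conorm g x (V x - mvfderiv (𝓡 n) (φ k) x) ^ p ∂μ) atTop (𝓝 0)

/-- The first Dirichlet eigenvalue `λ_{1,p}(Ω)` of the `p`-Laplacian through its variational
characterization, the infimum of `∫_Ω ‖∇u‖^p / ∫_Ω |u|^p` over the nonzero `u ∈ W_0^{1,p}(Ω)`. -/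
def lambdaOne (g : RiemannianMetric (fun x : M => TangentSpace (𝓡 n) x)) (μ : Measure M)
    (p : ℝ) (Ω : Set M) : ℝ≥0∞ :=
  ⨅ (u : M → ℝ) (V : ∀ x : M, TangentSpace (𝓡 n) x →L[ℝ] ℝ) (_ : IsW0 g μ p Ω u V)
    (_ : ¬ u =ᵐ[μ.restrict Ω] 0),
    (∫⁻ x in Ω, conorm g x (V x) ^ p ∂μ) / (∫⁻ x in Ω, ‖u x‖ₑ ^ p ∂μ)

/-- A positive definite symmetric bilinear form on each tangent space is a Riemannian metric: in
finite dimension its unit balls are bounded. -/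
theorem isVonNBounded_of_pos {E : Type*} [NormedAddCommGroup E] [NormedSpace ℝ E]
    [FiniteDimensional ℝ E] (B : E →L[ℝ] E →L[ℝ] ℝ) (hB : ∀ v, v ≠ 0 → 0 < B v v) :
    IsVonNBounded ℝ {v : E | B v v < 1} := by
  have hcont : Continuous fun v : E => B v v := by fun_prop
  rcases (Metric.sphere (0 : E) 1).eq_empty_or_nonempty with hs | hs
  · have hall : ∀ v : E, v = 0 := by
      intro v
      by_contra hv
      have : ‖v‖⁻¹ • v ∈ Metric.sphere (0 : E) 1 := by
        simp [norm_smul, hv]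
      rw [hs] at this
      exact this
    refine (NormedSpace.isVonNBounded_ball ℝ E 1).subset ?_
    intro v _
    simp [hall v]
  · obtain ⟨w, hw, hmin⟩ := (isCompact_sphere (0 : E) 1).exists_isMinOn hs hcont.continuousOn
    have hw0 : w ≠ 0 := by
      rintro rfl
      simp at hw
    set m := B w w with hm
    have hmpos : 0 < m := hB w hw0
    refine (NormedSpace.isVonNBounded_closedBall ℝ E (√(m⁻¹))).subset ?_
    intro v hv
    rcases eq_or_ne v 0 with rfl | hv0
    · simp
    have hvn : 0 < ‖v‖ := norm_pos_iff.2 hv0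
    have h1 : m ≤ B (‖v‖⁻¹ • v) (‖v‖⁻¹ • v) :=
      hmin (show ‖v‖⁻¹ • v ∈ Metric.sphere (0 : E) 1 by simp [norm_smul, hv0])
    simp only [map_smul, _root_.smul_apply, smul_eq_mul] at h1
    have h2 : m * ‖v‖ ^ 2 ≤ B v v := by
      have := mul_le_mul_of_nonneg_right h1 (sq_nonneg ‖v‖)
      calc m * ‖v‖ ^ 2 ≤ _ := this
        _ = B v v := by field_simp
    have h3 : B v v < 1 := hv
    rw [mem_closedBall_zero_iff]
    apply Real.le_sqrt_of_sq_le
    rw [← one_div, le_div_iff₀ hmpos]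
    nlinarith

end General

/-! ### The Euclidean space `M^n(0) = ℝ^n` -/

/-- The inner product of `ℝ^n` as a bilinear form. -/
def euclideanForm (n : ℕ) :
    EuclideanSpace ℝ (Fin n) →L[ℝ] EuclideanSpace ℝ (Fin n) →L[ℝ] ℝ :=
  innerSL ℝ

theorem euclideanForm_apply {n : ℕ} (v w : EuclideanSpace ℝ (Fin n)) :
    euclideanForm n v w = inner ℝ v w := rfl

/-- The flat metric of `ℝ^n`. Its volume measure is the Lebesgue measure `volume`. -/
def euclideanMetric (n : ℕ) :
    RiemannianMetric (fun x : EuclideanSpace ℝ (Fin n) => TangentSpace (𝓡 n) x) :=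
  (riemannianMetricVectorSpace (EuclideanSpace ℝ (Fin n))).toRiemannianMetric

/-! ### The hyperbolic space `M^n(c)`, `c < 0`

It is the upper sheet `{(x, s) : |x|² - s² = 1 / c, s > 0}` of the hyperboloid in Minkowski space
`ℝ^n × ℝ`, whose form is `⟨v, w⟩ - a b`. The sheet is the graph of the function `hypHeight c`, so
`x ∈ ℝ^n` serves as a global coordinate. -/

/-- The function whose graph is the hyperboloid sheet. -/
def hypHeight (n : ℕ) (c : ℝ) (x : EuclideanSpace ℝ (Fin n)) : ℝ :=
  √((-c)⁻¹ + ‖x‖ ^ 2)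

theorem hasFDerivAt_hypHeight {n : ℕ} {c : ℝ} (hc : c < 0) (x : EuclideanSpace ℝ (Fin n)) :
    HasFDerivAt (hypHeight n c) ((hypHeight n c x)⁻¹ • innerSL ℝ x) x := by
  have hpos : 0 < (-c)⁻¹ + ‖x‖ ^ 2 := by
    have : 0 < (-c)⁻¹ := inv_pos.2 (neg_pos.2 hc)
    positivity
  have h1 : HasFDerivAt (fun y : EuclideanSpace ℝ (Fin n) => (-c)⁻¹ + ‖y‖ ^ 2)
      (2 • innerSL ℝ x) x := (hasStrictFDerivAt_norm_sq x).hasFDerivAt.const_add _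
  convert! h1.sqrt hpos.ne' using 1
  ext v
  simp only [hypHeight, _root_.smul_apply, smul_eq_mul, nsmul_eq_mul]
  have : √((-c)⁻¹ + ‖x‖ ^ 2) ≠ 0 := (Real.sqrt_pos.2 hpos).ne'
  simp
  field_simp

/-- The pullback of the Minkowski form `⟨v, w⟩ - a b` under `x ↦ (x, hypHeight n c x)`. -/
def hypForm (n : ℕ) (c : ℝ) (x : EuclideanSpace ℝ (Fin n)) :
    EuclideanSpace ℝ (Fin n) →L[ℝ] EuclideanSpace ℝ (Fin n) →L[ℝ] ℝ :=
  euclideanForm n -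
    (fderiv ℝ (hypHeight n c) x).smulRight (fderiv ℝ (hypHeight n c) x)

theorem hypForm_apply (n : ℕ) (c : ℝ) (x v w : EuclideanSpace ℝ (Fin n)) :
    hypForm n c x v w =
      inner ℝ v w - fderiv ℝ (hypHeight n c) x v * fderiv ℝ (hypHeight n c) x w := by
  simp [hypForm, euclideanForm_apply]

theorem hypForm_symm {n : ℕ} (c : ℝ) (x v w : EuclideanSpace ℝ (Fin n)) :
    hypForm n c x v w = hypForm n c x w v := by
  rw [hypForm_apply, hypForm_apply, real_inner_comm, mul_comm]

theorem hypForm_pos {n : ℕ} {c : ℝ} (hc : c < 0) (x v : EuclideanSpace ℝ (Fin n)) (hv : v ≠ 0) :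
    0 < hypForm n c x v v := by
  have hk : 0 < (-c)⁻¹ := inv_pos.2 (neg_pos.2 hc)
  have hpos : 0 < (-c)⁻¹ + ‖x‖ ^ 2 := by positivity
  have hh : 0 < hypHeight n c x := Real.sqrt_pos.2 hpos
  have hsq : hypHeight n c x ^ 2 = (-c)⁻¹ + ‖x‖ ^ 2 := Real.sq_sqrt hpos.le
  rw [hypForm_apply, (hasFDerivAt_hypHeight hc x).fderiv, real_inner_self_eq_norm_sq]
  simp only [_root_.smul_apply, innerSL_apply_apply, smul_eq_mul]
  have hvn : 0 < ‖v‖ ^ 2 := by positivity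
  have hcs : (inner ℝ x v : ℝ) ^ 2 ≤ ‖x‖ ^ 2 * ‖v‖ ^ 2 := by
    have := abs_real_inner_le_norm x v
    rw [← mul_pow, ← sq_abs]
    gcongr
  have : (hypHeight n c x)⁻¹ * inner ℝ x v * ((hypHeight n c x)⁻¹ * inner ℝ x v)
      = (inner ℝ x v) ^ 2 / hypHeight n c x ^ 2 := by
    field_simp
  rw [this, sub_pos, div_lt_iff₀ (by positivity), hsq]
  nlinarith

/-- The Riemannian metric of the hyperbolic space of curvature `c < 0`. -/
def hypMetric (n : ℕ) (c : ℝ) (hc : c < 0) :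
    RiemannianMetric (fun x : EuclideanSpace ℝ (Fin n) => TangentSpace (𝓡 n) x) where
  inner x := hypForm n c x
  symm x v w := hypForm_symm c x v w
  pos x v hv := hypForm_pos hc x v hv
  continuousAt x := by
    have : Continuous fun v : EuclideanSpace ℝ (Fin n) => hypForm n c x v v := by fun_prop
    exact this.continuousAt
  isVonNBounded x := isVonNBounded_of_pos (hypForm n c x) (hypForm_pos hc x)

/-- The volume measure `√(det g_ij) dx` of the hyperbolic space of curvature `c < 0`. -/
def hypVolume (n : ℕ) (c : ℝ) : Measure (EuclideanSpace ℝ (Fin n)) :=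
  (volume : Measure (EuclideanSpace ℝ (Fin n))).withDensity fun x =>
    ENNReal.ofReal (√(Matrix.det (Matrix.of fun i j : Fin n =>
      hypForm n c x (EuclideanSpace.single i 1) (EuclideanSpace.single j 1))))

/-! ### The sphere `M^n(c)`, `c > 0`

It is the sphere of radius `1 / √c` in `ℝ^{n+1}`, carried to the unit sphere by the homothety
`y ↦ √c y`: the metric is `1 / c` times the one of the unit sphere. -/

/-- The unit sphere of `ℝ^{n+1}`. -/
abbrev Sph (n : ℕ) : Type := Metric.sphere (0 : EuclideanSpace ℝ (Fin (n + 1))) 1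

/-- The differential at `x` of the inclusion of the unit sphere in `ℝ^{n+1}`. -/
def dIncl (n : ℕ) (x : Sph n) : TangentSpace (𝓡 n) x →L[ℝ] EuclideanSpace ℝ (Fin (n + 1)) :=
  mvfderiv (𝓡 n) (Subtype.val : Sph n → EuclideanSpace ℝ (Fin (n + 1))) x

/-- `1 / c` times the pullback to the unit sphere of the inner product of `ℝ^{n+1}`. -/
def sphForm (n : ℕ) (c : ℝ) (x : Sph n) :
    TangentSpace (𝓡 n) x →L[ℝ] TangentSpace (𝓡 n) x →L[ℝ] ℝ :=
  c⁻¹ • ((dIncl n x).precomp ℝ ∘L euclideanForm (n + 1) ∘L dIncl n x)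

theorem sphForm_apply (n : ℕ) (c : ℝ) (x : Sph n) (v w : TangentSpace (𝓡 n) x) :
    sphForm n c x v w = c⁻¹ * inner ℝ (dIncl n x v) (dIncl n x w) := by
  simp [sphForm, euclideanForm_apply]

theorem sphForm_pos {n : ℕ} {c : ℝ} (hc : 0 < c) (x : Sph n) (v : TangentSpace (𝓡 n) x)
    (hv : v ≠ 0) : 0 < sphForm n c x v v := by
  rw [sphForm_apply]
  have : Fact (Module.finrank ℝ (EuclideanSpace ℝ (Fin (n + 1))) = n + 1) :=
    ⟨finrank_euclideanSpace_fin⟩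
  have hinj : Function.Injective (dIncl n x) := injective_mvfderiv_subtypeVal_sphere x
  have : dIncl n x v ≠ 0 := fun h => hv (hinj (by rw [h, map_zero]))
  have := real_inner_self_pos.2 this
  positivity

/-- The Riemannian metric of the sphere of curvature `c > 0`. -/
def sphMetric (n : ℕ) (c : ℝ) (hc : 0 < c) :
    RiemannianMetric (fun x : Sph n => TangentSpace (𝓡 n) x) where
  inner x := sphForm n c x
  symm x v w := by rw [sphForm_apply, sphForm_apply, real_inner_comm]
  pos x v hv := sphForm_pos hc x v hv
  continuousAt x := by
    have : Continuous fun v : TangentSpace (𝓡 n) x => sphForm n c x v v := by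
      have := (dIncl n x).continuous
      simp only [sphForm_apply]
      fun_prop
    exact this.continuousAt
  isVonNBounded x :=
    isVonNBounded_of_pos (E := EuclideanSpace ℝ (Fin n)) (sphForm n c x) (sphForm_pos hc x)

/-- The volume measure of the sphere of curvature `c > 0`: the surface measure of the unit sphere,
`A ↦ (n + 1) · volume {t a : 0 < t < 1, a ∈ A}`, times `(1 / √c) ^ n`. -/
def sphVolume (n : ℕ) (c : ℝ) : Measure (Sph n) :=
  ENNReal.ofReal ((√c)⁻¹ ^ n) •
    (volume : Measure (EuclideanSpace ℝ (Fin (n + 1)))).toSphere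

end SpaceForm

end

namespace SpaceForm

section General

variable {n : ℕ} {M : Type*} [TopologicalSpace M] [ChartedSpace (EuclideanSpace ℝ (Fin n)) M]
  (g : RiemannianMetric (fun x : M => TangentSpace (𝓡 n) x))

/-! ### Covectors and distances -/

/-! The bound is a Barta-type estimate. Suppose a vector field `X` has norm at most one and
divergence at least `K ≥ 0` on `Ω`. Integrating `|φ|^p` against the divergence gives `K ∫|φ|^p ≤ p
∫|φ|^(p-1) |dφ|`, and Hölder turns this into `K ‖φ‖_p ≤ p ‖dφ‖_p`. By density this yields `λ ≥
(K/p)^p` (`HasDivergence.ofReal_le_lambdaOne`).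

The natural field is `∇r`, with `r` the distance to the center. Its divergence `Δr` is `n - 1` times
`√(-c) coth(√(-c) r)`, `1/r` or `√c cot(√c r)`, which decreases in `r`, so on the ball it is at
least its value at `R`.

As `∇r` is singular at the center, `r` is replaced by a function `F` of `r` (`cosh`, `r²/2` or
`-cos`) with Hessian `H(F) g`. Its gradient `Y` satisfies `|Y|² = A(F)` and `div Y = n H(F)`, where
`A' = 2H`. The field `Y / √(A(F) + δ)` has norm at most one and, where `H(F) ≥ 0`, divergence at
least `(n - 1) H(F) / √(A(F) + δ)` (`HasDivergence.normalize`). Letting `δ → 0` gives the stated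
constant.

That `F` on the geodesic ball is at most its value at radius `R` comes from the same data. A
primitive of `1 / √(A + δ)` composed with `F` is 1-Lipschitz, and in the limit it is the distance up
to a constant (`IsConformalGradient.sub_lt`). The models supply `F`, its gradient and the divergence
formula. In `ℝ^n` and hyperbolic space the latter is a computation in the global chart; on the
sphere it descends from `ℝ^(n+1)` in polar coordinates. -/

theorem le_conorm {x : M} {v : TangentSpace (𝓡 n) x} (hv : g.inner x v v ≤ 1)
    (α : TangentSpace (𝓡 n) x →L[ℝ] ℝ) : ‖α v‖ₑ ≤ conorm g x α := by
  rw [Real.enorm_eq_ofReal_abs]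
  rcases abs_choice (α v) with h | h <;> rw [h]
  · exact le_iSup₂ (f := fun (v : TangentSpace (𝓡 n) x) (_ : g.inner x v v ≤ 1) =>
      ENNReal.ofReal (α v)) v hv
  · rw [← map_neg]
    exact le_iSup₂ (f := fun (v : TangentSpace (𝓡 n) x) (_ : g.inner x v v ≤ 1) =>
      ENNReal.ofReal (α v)) (-v) (by simpa using hv)

theorem conorm_sub_le (x : M) (α β : TangentSpace (𝓡 n) x →L[ℝ] ℝ) :
    conorm g x (α - β) ≤ conorm g x α + conorm g x β := by
  refine iSup₂_le fun v hv => ?_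
  rw [_root_.sub_apply, sub_eq_add_neg]
  refine ENNReal.ofReal_add_le.trans (add_le_add ?_ ?_)
  · exact (ENNReal.ofReal_le_ofReal (le_abs_self _)).trans
      ((Real.enorm_eq_ofReal_abs _).symm.le.trans (le_conorm g hv α))
  · exact (ENNReal.ofReal_le_ofReal (neg_le_abs _)).trans
      ((Real.enorm_eq_ofReal_abs _).symm.le.trans (le_conorm g hv β))

/-- The Cauchy–Schwarz inequality for a Riemannian metric. -/
theorem inner_sq_le (x : M) (v w : TangentSpace (𝓡 n) x) :
    g.inner x v w ^ 2 ≤ g.inner x v v * g.inner x w w := by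
  have h := @InnerProductSpace.Core.inner_mul_inner_self_le ℝ _ _ _ _
    (g.toCore x).toCore v w
  change ‖g.inner x v w‖ * ‖g.inner x w v‖ ≤ g.inner x v v * g.inner x w w at h
  rwa [g.symm x w v, Real.norm_eq_abs, abs_mul_abs_self, ← sq] at h

/-- A `C^1` function whose gradient has norm at most one is 1-Lipschitz for the geodesic
distance. -/
theorem sub_lt_of_mem_geodesicBall {ψ : M → ℝ} (hψ : ContMDiff (𝓡 n) 𝓘(ℝ, ℝ) 1 ψ)
    (hle : ∀ x v, |mvfderiv (𝓡 n) ψ x v| ≤ √(g.inner x v v)) {q x : M} {R : ℝ}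
    (hx : x ∈ geodesicBall g q R) : ψ x - ψ q < R := by
  let _ : RiemannianBundle (fun x : M => TangentSpace (𝓡 n) x) := ⟨g⟩
  have hx' : riemannianEDist (𝓡 n) q x < ENNReal.ofReal R := hx
  obtain ⟨γ, h0, h1, hγ, hlen⟩ := exists_lt_of_riemannianEDist_lt hx'
  have hc : ContDiffOn ℝ 1 (ψ ∘ γ) (Icc 0 1) := by
    rw [← contMDiffOn_iff_contDiffOn]
    exact hψ.comp_contMDiffOn hγ
  -- The increment of `ψ` along a path is at most the integral of the speed of `ψ ∘ γ`, which the
  -- gradient bound compares pointwise with the speed of `γ`.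
  have key : ‖(ψ ∘ γ) 1 - (ψ ∘ γ) 0‖ₑ ≤ pathELength (𝓡 n) γ 0 1 := by
    refine (enorm_sub_le_lintegral_derivWithin_Icc_of_contDiffOn_Icc hc zero_le_one).trans ?_
    rw [pathELength_eq_lintegral_mfderivWithin_Icc]
    refine setLIntegral_mono' measurableSet_Icc fun t ht => ?_
    have hd : derivWithin (ψ ∘ γ) (Icc 0 1) t =
        mvfderiv (𝓡 n) ψ (γ t) (mfderivWithin 𝓘(ℝ, ℝ) (𝓡 n) γ (Icc 0 1) t 1) := by
      have := mfderiv_comp_mfderivWithin t (hψ.mdifferentiable one_ne_zero (γ t))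
        (hγ.mdifferentiableOn one_ne_zero t ht)
        (uniqueMDiffWithinAt_iff_uniqueDiffWithinAt.2 (uniqueDiffOn_Icc zero_lt_one t ht))
      rw [← fderivWithin_derivWithin, ← mfderivWithin_eq_fderivWithin, this]
      rfl
    rw [hd, Real.enorm_eq_ofReal_abs, ← ofReal_norm]
    refine ENNReal.ofReal_le_ofReal ((hle _ _).trans_eq ?_)
    rw [norm_eq_sqrt_real_inner]
    rfl
  have := key.trans_lt hlen
  rw [Function.comp, Function.comp, h0, h1, Real.enorm_eq_ofReal_abs] at this
  exact (le_abs_self _).trans_lt (ENNReal.ofReal_lt_ofReal_iff'.1 this).1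

/-! ### Barta's inequality -/

theorem IsTestFunction.mono {Ω Ω' : Set M} {φ : M → ℝ} (h : IsTestFunction (n := n) Ω φ)
    (hs : Ω ⊆ Ω') : IsTestFunction (n := n) Ω' φ :=
  ⟨h.contMDiff, h.compact, h.subset.trans hs⟩

theorem isTestFunction_zero (Ω : Set M) : IsTestFunction (n := n) Ω (0 : M → ℝ) :=
  ⟨contMDiff_const, HasCompactSupport.zero, by simp [tsupport]⟩

theorem mvfderiv_comp_of_hasDerivAt {f : M → ℝ} {x : M} {h : ℝ → ℝ} {h' : ℝ}
    (hh : HasDerivAt h h' (f x)) (hf : MDifferentiableAt (𝓡 n) 𝓘(ℝ, ℝ) f x)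
    (v : TangentSpace (𝓡 n) x) :
    mvfderiv (𝓡 n) (fun y => h (f y)) x v = h' * mvfderiv (𝓡 n) f x v := by
  have := mfderiv_comp_apply (I' := 𝓘(ℝ, ℝ)) x hh.differentiableAt.mdifferentiableAt hf v
  refine this.trans ?_
  change (mfderiv 𝓘(ℝ, ℝ) 𝓘(ℝ, ℝ) h (f x)) (mvfderiv (𝓡 n) f x v) = _
  rw [mfderiv_eq_fderiv, hh.hasFDerivAt.fderiv]
  exact mul_comm (mvfderiv (𝓡 n) f x v) h'

/-- The vector field `X` is continuous and has the continuous divergence `D` with respect to `μ`,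
in the sense of integration by parts against `C^1` functions of compact support. -/
structure HasDivergence [MeasurableSpace M] (μ : Measure M) (X : ∀ x : M, TangentSpace (𝓡 n) x)
    (D : M → ℝ) : Prop where
  continuous_apply : ∀ f : M → ℝ, ContMDiff (𝓡 n) 𝓘(ℝ, ℝ) 1 f →
    Continuous fun x => mvfderiv (𝓡 n) f x (X x)
  continuous_div : Continuous D
  integral_eq : ∀ f : M → ℝ, ContMDiff (𝓡 n) 𝓘(ℝ, ℝ) 1 f → HasCompactSupport f →
    ∫ x, mvfderiv (𝓡 n) f x (X x) ∂μ = -∫ x, f x * D x ∂μ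

variable [MeasurableSpace M] [BorelSpace M] {μ : Measure M} [IsFiniteMeasureOnCompacts μ]
  {X : ∀ x : M, TangentSpace (𝓡 n) x} {D : M → ℝ} {p K : ℝ} {Ω : Set M}

/-- The function `|φ|^p` is `C^1` because `p > 1`, so it is admissible in the integration by parts
for `X`. Its differential contributes the factor `p |φ|^(p-1)`. -/
theorem HasDivergence.mul_lintegral_le (hD : HasDivergence μ X D) (hp : 1 < p)
    (hK : ∀ x ∈ Ω, K ≤ D x) (hΩ : MeasurableSet Ω) {φ : M → ℝ}
    (hφ : IsTestFunction (n := n) Ω φ) :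
    ENNReal.ofReal K * ∫⁻ x in Ω, ‖φ x‖ₑ ^ p ∂μ ≤ ENNReal.ofReal p *
      ∫⁻ x in Ω, ‖φ x‖ₑ ^ (p - 1) * ‖mvfderiv (𝓡 n) φ x (X x)‖ₑ ∂μ := by
  rcases le_total K 0 with hK0 | hK0
  · simp [ENNReal.ofReal_of_nonpos hK0]
  have hφ1 : ContMDiff (𝓡 n) 𝓘(ℝ, ℝ) 1 φ := hφ.contMDiff.of_le (by simp)
  have hη1 : ContMDiff (𝓡 n) 𝓘(ℝ, ℝ) 1 fun x => ‖φ x‖ ^ p :=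
    (contDiff_norm_rpow hp).contMDiff.comp hφ1
  have hηc : HasCompactSupport fun x => ‖φ x‖ ^ p :=
    hφ.compact.comp_left (g := fun t : ℝ => ‖t‖ ^ p) (by
      rw [norm_zero, Real.zero_rpow (by linarith)])
  have hzero : ∀ x, x ∉ Ω → φ x = 0 := fun x hx =>
    image_eq_zero_of_notMem_tsupport fun h => hx (hφ.subset h)
  have hint : Integrable (fun x => ‖φ x‖ ^ p * D x) μ :=
    (hη1.continuous.mul hD.continuous_div).integrable_of_hasCompactSupport hηc.mul_right
  have hle : ∀ x ∈ Ω, K * ‖φ x‖ ^ p ≤ ‖φ x‖ ^ p * D x := fun x hx => by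
    rw [mul_comm]
    exact mul_le_mul_of_nonneg_left (hK x hx) (by positivity)
  have henorm : ∀ x, ‖φ x‖ₑ ^ p = ENNReal.ofReal (‖φ x‖ ^ p) := fun x => by
    rw [← ofReal_norm, ENNReal.ofReal_rpow_of_nonneg (norm_nonneg _) (by linarith)]
  calc ENNReal.ofReal K * ∫⁻ x in Ω, ‖φ x‖ₑ ^ p ∂μ
      = ∫⁻ x in Ω, ENNReal.ofReal (K * ‖φ x‖ ^ p) ∂μ := by
        rw [← lintegral_const_mul' _ _ ENNReal.ofReal_ne_top]
        simp_rw [henorm, ENNReal.ofReal_mul hK0]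
    _ ≤ ∫⁻ x in Ω, ENNReal.ofReal (‖φ x‖ ^ p * D x) ∂μ :=
        setLIntegral_mono' hΩ fun x hx => ENNReal.ofReal_le_ofReal (hle x hx)
    _ = ENNReal.ofReal (∫ x in Ω, ‖φ x‖ ^ p * D x ∂μ) := by
        rw [ofReal_integral_eq_lintegral_ofReal hint.integrableOn]
        exact (ae_restrict_iff' hΩ).2 <| .of_forall fun x hx =>
          (mul_nonneg hK0 (by positivity)).trans (hle x hx)
    _ = ENNReal.ofReal (∫ x, ‖φ x‖ ^ p * D x ∂μ) := by
        rw [setIntegral_eq_integral_of_forall_compl_eq_zero fun x hx => ?_]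
        rw [hzero x hx, norm_zero, Real.zero_rpow (by linarith), zero_mul]
    _ ≤ ‖∫ x, mvfderiv (𝓡 n) (fun x => ‖φ x‖ ^ p) x (X x) ∂μ‖ₑ := by
        rw [hD.integral_eq _ hη1 hηc, enorm_neg, Real.enorm_eq_ofReal_abs]
        exact ENNReal.ofReal_le_ofReal (le_abs_self _)
    _ ≤ ∫⁻ x, ‖mvfderiv (𝓡 n) (fun x => ‖φ x‖ ^ p) x (X x)‖ₑ ∂μ :=
        enorm_integral_le_lintegral_enorm _
    _ = ∫⁻ x, ENNReal.ofReal p *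
          (‖φ x‖ₑ ^ (p - 1) * ‖mvfderiv (𝓡 n) φ x (X x)‖ₑ) ∂μ := by
        refine lintegral_congr fun x => ?_
        rw [mvfderiv_comp_of_hasDerivAt (hasDerivAt_norm_rpow (φ x) hp)
          (hφ1.mdifferentiable one_ne_zero x), enorm_mul, ← mul_assoc]
        congr 1
        rw [enorm_mul, enorm_mul, Real.enorm_of_nonneg (by linarith : 0 ≤ p),
          Real.enorm_of_nonneg (by positivity), mul_assoc]
        congr 1
        rw [← ofReal_norm, ← ENNReal.ofReal_mul (by positivity),
          ENNReal.ofReal_rpow_of_nonneg (norm_nonneg _) (by linarith)]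
        rcases eq_or_ne (φ x) 0 with h | h
        · simp [h, Real.zero_rpow (by linarith : p - 1 ≠ 0)]
        · rw [← Real.rpow_add_one (norm_ne_zero_iff.2 h)]
          ring_nf
    _ = ∫⁻ x in Ω, ENNReal.ofReal p *
          (‖φ x‖ₑ ^ (p - 1) * ‖mvfderiv (𝓡 n) φ x (X x)‖ₑ) ∂μ := by
        rw [setLIntegral_eq_of_support_subset]
        intro x hx
        by_contra h
        refine hx ?_
        simp [hzero x h, ENNReal.zero_rpow_of_pos (by linarith : 0 < p - 1)]
    _ = _ := lintegral_const_mul' _ _ ENNReal.ofReal_ne_top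

/-- Barta's inequality for test functions. -/
theorem HasDivergence.mul_lpNorm_le (hD : HasDivergence μ X D) (hp : 1 < p)
    (hK : ∀ x ∈ Ω, K ≤ D x) (hΩ : MeasurableSet Ω) (hX : ∀ x, g.inner x (X x) (X x) ≤ 1)
    {φ : M → ℝ} (hφ : IsTestFunction (n := n) Ω φ) :
    ENNReal.ofReal K * (∫⁻ x in Ω, ‖φ x‖ₑ ^ p ∂μ) ^ (1 / p) ≤
      ENNReal.ofReal p * (∫⁻ x in Ω, conorm g x (mvfderiv (𝓡 n) φ x) ^ p ∂μ) ^ (1 / p) := by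
  have hφ1 : ContMDiff (𝓡 n) 𝓘(ℝ, ℝ) 1 φ := hφ.contMDiff.of_le (by simp)
  set a := ∫⁻ x in Ω, ‖φ x‖ₑ ^ p ∂μ with ha
  set b := ∫⁻ x in Ω, conorm g x (mvfderiv (𝓡 n) φ x) ^ p ∂μ with hb
  have hp0 : 0 < p := by linarith
  have hatop : a ≠ ⊤ := by
    have h1 : MemLp φ (ENNReal.ofReal p) μ :=
      hφ1.continuous.memLp_of_hasCompactSupport hφ.compact
    have h2 := h1.restrict Ω
    have := lintegral_rpow_enorm_lt_top_of_eLpNorm_lt_top (by simpa using hp0)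
      ENNReal.ofReal_ne_top h2.2
    rw [ENNReal.toReal_ofReal hp0.le] at this
    exact this.ne
  have hpq : (p / (p - 1)).HolderConjugate p := (Real.HolderConjugate.conjExponent hp).symm
  have hHolder : ∫⁻ x in Ω, ‖φ x‖ₑ ^ (p - 1) * ‖mvfderiv (𝓡 n) φ x (X x)‖ₑ ∂μ ≤
      a ^ (1 - 1 / p) * b ^ (1 / p) := by
    refine (ENNReal.lintegral_mul_le_Lp_mul_Lq _ hpq (f := fun x => ‖φ x‖ₑ ^ (p - 1))
      (g := fun x => ‖mvfderiv (𝓡 n) φ x (X x)‖ₑ)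
      (hφ1.continuous.enorm.measurable.pow_const _).aemeasurable
      (hD.continuous_apply φ hφ1).enorm.measurable.aemeasurable).trans ?_
    have hp1 : p - 1 ≠ 0 := by linarith
    have e1 : 1 / (p / (p - 1)) = 1 - 1 / p := by field_simp
    have e2 : (p - 1) * (p / (p - 1)) = p := by field_simp
    simp_rw [← ENNReal.rpow_mul]
    rw [e1, e2]
    exact mul_le_mul_right (ENNReal.rpow_le_rpow (lintegral_mono fun x =>
      ENNReal.rpow_le_rpow (le_conorm g (hX x) _) hp0.le) (by positivity)) _
  rcases eq_or_ne a 0 with h0 | h0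
  · rw [h0, ENNReal.zero_rpow_of_pos (by positivity), mul_zero]
    -- From here on `0 < a < ∞`, so the Hölder factor `a ^ (1 - 1/p)` can be cancelled from both
    -- sides.
    exact zero_le
  have hpos : a ^ (1 - 1 / p) ≠ 0 := by simp [h0, hatop]
  have hfin : a ^ (1 - 1 / p) ≠ ⊤ := by simp [h0, hatop]
  have h := (hD.mul_lintegral_le hp hK hΩ hφ).trans (mul_le_mul_right hHolder _)
  rw [← ENNReal.mul_le_mul_iff_right hpos hfin]
  calc a ^ (1 - 1 / p) * (ENNReal.ofReal K * a ^ (1 / p))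
      = ENNReal.ofReal K * a := by
        rw [mul_left_comm, ← ENNReal.rpow_add _ _ h0 hatop]
        simp
    _ ≤ _ := h
    _ = _ := by rw [mul_left_comm]

/-- Both sides of the test-function inequality are `L^p` norms, so Minkowski lets it pass to limits
in `W^{1,p}`. Raising the limit inequality to the power `p` gives the bound on the quotient. -/
theorem HasDivergence.ofReal_le_lambdaOne (hD : HasDivergence μ X D) (hp : 1 < p)
    (hK0 : 0 ≤ K) (hK : ∀ x ∈ Ω, K ≤ D x) (hΩ : MeasurableSet Ω)
    (hX : ∀ x, g.inner x (X x) (X x) ≤ 1) :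
    ENNReal.ofReal ((K / p) ^ p) ≤ lambdaOne g μ p Ω := by
  have hp0 : 0 < p := by linarith
  refine le_iInf₂ fun u V => le_iInf₂ fun hu hu0 => ?_
  obtain ⟨φ, hφ, hφu, hφV⟩ := hu.exists_seq
  have htest : ∀ k, IsTestFunction (n := n) univ (φ k) := fun k => (hφ k).mono (subset_univ _)
  have hV : AEMeasurable (fun x => conorm g x (V x)) (μ.restrict Ω) := by
    -- Measurability of the norm of `V` itself is the case of the zero test function.
    have := hu.aemeasurable 0 (isTestFunction_zero _)
    have e : ∀ x : M, mvfderiv (𝓡 n) (0 : M → ℝ) x = 0 := fun x => mvfderiv_zero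
    simpa [e] using this
  set a := ∫⁻ x in Ω, ‖u x‖ₑ ^ p ∂μ with ha
  set b := ∫⁻ x in Ω, conorm g x (V x) ^ p ∂μ with hb
  have ha0 : a ≠ 0 := by
    intro h
    rw [lintegral_eq_zero_iff' (hu.memLp.1.enorm.pow_const _)] at h
    refine hu0 (h.mono fun x hx => ?_)
    simpa [ENNReal.rpow_eq_zero_iff, hp0, hp0.le.not_gt] using hx
  have hatop : a ≠ ⊤ := by
    have := lintegral_rpow_enorm_lt_top_of_eLpNorm_lt_top (by simpa using hp0)
      ENNReal.ofReal_ne_top hu.memLp.2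
    rw [ENNReal.toReal_ofReal hp0.le] at this
    exact this.ne
  have hstep : ∀ k, ENNReal.ofReal K * a ^ (1 / p) ≤
      ENNReal.ofReal p * (b ^ (1 / p) +
        (∫⁻ x in Ω, conorm g x (V x - mvfderiv (𝓡 n) (φ k) x) ^ p ∂μ) ^ (1 / p)) +
      ENNReal.ofReal K * (∫⁻ x in Ω, ‖u x - φ k x‖ₑ ^ p ∂μ) ^ (1 / p) := by
    intro k
    have hφc : Continuous (φ k) := (hφ k).contMDiff.continuous
    have h1 : a ^ (1 / p) ≤ (∫⁻ x in Ω, ‖φ k x‖ₑ ^ p ∂μ) ^ (1 / p) +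
        (∫⁻ x in Ω, ‖u x - φ k x‖ₑ ^ p ∂μ) ^ (1 / p) := by
      refine le_trans ?_ (ENNReal.lintegral_Lp_add_le
        hφc.enorm.measurable.aemeasurable
        (hu.memLp.1.sub hφc.measurable.aestronglyMeasurable).enorm hp.le)
      refine ENNReal.rpow_le_rpow (lintegral_mono fun x => ENNReal.rpow_le_rpow ?_ hp0.le)
        (by positivity)
      simpa using enorm_add_le (φ k x) (u x - φ k x)
    have h2 : (∫⁻ x in Ω, conorm g x (mvfderiv (𝓡 n) (φ k) x) ^ p ∂μ) ^ (1 / p) ≤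
        b ^ (1 / p) +
        (∫⁻ x in Ω, conorm g x (V x - mvfderiv (𝓡 n) (φ k) x) ^ p ∂μ) ^ (1 / p) := by
      refine le_trans ?_ (ENNReal.lintegral_Lp_add_le hV (hu.aemeasurable _ (htest k)) hp.le)
      refine ENNReal.rpow_le_rpow (lintegral_mono fun x => ENNReal.rpow_le_rpow ?_ hp0.le)
        (by positivity)
      have := conorm_sub_le g x (V x) (V x - mvfderiv (𝓡 n) (φ k) x)
      rwa [sub_sub_cancel] at this
    calc ENNReal.ofReal K * a ^ (1 / p) ≤ ENNReal.ofReal K * _ := mul_le_mul_right h1 _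
      _ ≤ _ := by
        rw [mul_add]
        refine add_le_add_left ?_ _
        exact (hD.mul_lpNorm_le g hp hK hΩ hX (hφ k)).trans (mul_le_mul_right h2 _)
  have hp' : 0 < 1 / p := by positivity
  have hroot : ∀ {f : ℕ → ℝ≥0∞}, Tendsto f atTop (𝓝 0) →
      Tendsto (fun k => f k ^ (1 / p)) atTop (𝓝 0) := fun {f} hf => by
    have := hf.ennrpow_const (1 / p)
    rwa [ENNReal.zero_rpow_of_pos hp'] at this
  have hlim : ENNReal.ofReal K * a ^ (1 / p) ≤ ENNReal.ofReal p * b ^ (1 / p) := by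
    have h1 := ENNReal.Tendsto.const_mul (a := ENNReal.ofReal p)
      ((tendsto_const_nhds (x := b ^ (1 / p))).add (hroot hφV)) (.inr ENNReal.ofReal_ne_top)
    have h2 := ENNReal.Tendsto.const_mul (a := ENNReal.ofReal K) (hroot hφu)
      (.inr ENNReal.ofReal_ne_top)
    have := ge_of_tendsto' (h1.add h2) hstep
    simpa using this
  have hpow := ENNReal.rpow_le_rpow hlim hp0.le
  rw [ENNReal.mul_rpow_of_nonneg _ _ hp0.le, ENNReal.mul_rpow_of_nonneg _ _ hp0.le,
    ← ENNReal.rpow_mul, ← ENNReal.rpow_mul, one_div_mul_cancel hp0.ne', ENNReal.rpow_one,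
    ENNReal.rpow_one, ENNReal.ofReal_rpow_of_nonneg hK0 hp0.le,
    ENNReal.ofReal_rpow_of_nonneg hp0.le hp0.le] at hpow
  rw [ENNReal.le_div_iff_mul_le (.inl ha0) (.inl hatop), Real.div_rpow hK0 hp0.le,
    ENNReal.ofReal_div_of_pos (by positivity), ← ENNReal.mul_div_right_comm]
  exact ENNReal.div_le_of_le_mul' hpow

end General
section Conformal

variable {n : ℕ} {M : Type*} [TopologicalSpace M] [ChartedSpace (EuclideanSpace ℝ (Fin n)) M]
  {g : RiemannianMetric (fun x : M => TangentSpace (𝓡 n) x)}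

/-! ### Functions with conformal gradient

A function `F` whose Hessian is `H(F) g`, so that `‖∇F‖² = A(F)` with `A' = 2 H` and
`ΔF = n H(F)`. In a space form such an `F` is a function of the distance to a point. -/

/-- `Y` is the gradient of `F`, and `‖Y‖² = A(F)`. -/
structure IsConformalGradient (g : RiemannianMetric (fun x : M => TangentSpace (𝓡 n) x))
    (F : M → ℝ) (Y : ∀ x : M, TangentSpace (𝓡 n) x) (A : ℝ → ℝ) : Prop where
  contMDiff : ContMDiff (𝓡 n) 𝓘(ℝ, ℝ) 1 F
  mvfderiv_eq : ∀ x v, mvfderiv (𝓡 n) F x v = g.inner x (Y x) v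
  inner_self : ∀ x, g.inner x (Y x) (Y x) = A (F x)

variable {F : M → ℝ} {Y : ∀ x : M, TangentSpace (𝓡 n) x} {A H : ℝ → ℝ} {δ : ℝ}

theorem IsConformalGradient.nonneg (h : IsConformalGradient g F Y A) (x : M) : 0 ≤ A (F x) := by
  rw [← h.inner_self]
  rcases eq_or_ne (Y x) 0 with h0 | h0
  · simp [h0]
  · exact (g.pos x _ h0).le

/-- By Cauchy–Schwarz, `|d(G ∘ F)(v)|² ≤ A(F)/(A(F) + δ) · g(v, v)`, so `G ∘ F` is 1-Lipschitz. The
positive `δ` keeps `G` differentiable at the critical values of `F`, where `A` vanishes. -/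
theorem IsConformalGradient.sub_lt (h : IsConformalGradient g F Y A) (hδ : 0 < δ) {G : ℝ → ℝ}
    (hG : ∀ x, ContDiffAt ℝ 1 G (F x))
    (hG' : ∀ x, HasDerivAt G (1 / √(A (F x) + δ)) (F x)) {q x : M} {R : ℝ}
    (hx : x ∈ geodesicBall g q R) : G (F x) - G (F q) < R := by
  refine sub_lt_of_mem_geodesicBall g (ψ := fun x => G (F x))
    (fun x => (hG x).contMDiffAt.comp x (h.contMDiff x)) (fun x v => ?_) hx
  have hA := h.nonneg x
  rw [mvfderiv_comp_of_hasDerivAt (hG' x) (h.contMDiff.mdifferentiable one_ne_zero x),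
    h.mvfderiv_eq]
  apply Real.abs_le_sqrt
  have hcs := inner_sq_le g x (Y x) v
  rw [h.inner_self] at hcs
  have hv : 0 ≤ g.inner x v v := by
    rcases eq_or_ne v 0 with h0 | h0
    · simp [h0]
    · exact (g.pos x _ h0).le
  rw [mul_pow, div_pow, Real.sq_sqrt (by positivity), one_pow, one_div_mul_eq_div,
    div_le_iff₀ (by positivity)]
  nlinarith

theorem mvfderiv_eq_zero_of_notMem_tsupport {f : M → ℝ} {x : M} (hx : x ∉ tsupport f) :
    mvfderiv (𝓡 n) f x = 0 := by
  have h : f =ᶠ[𝓝 x] fun _ => (0 : ℝ) := notMem_tsupport_iff_eventuallyEq.1 hx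
  have := h.mfderiv_eq (I := 𝓡 n) (I' := 𝓘(ℝ, ℝ))
  rw [mfderiv_const] at this
  ext v
  change mfderiv (𝓡 n) 𝓘(ℝ, ℝ) f x v = 0
  rw [this]
  rfl

variable [MeasurableSpace M] [BorelSpace M] {μ : Measure M} [IsFiniteMeasureOnCompacts μ]

/-- This is the product rule `div(bY) = b div Y + db(Y)` with `b = (A(F) + δ)^(-1/2)`. Since `A' =
2H` and `dF(Y) = A(F)`, one has `db(Y) = -H A / (A + δ)^(3/2)`. In weak form, the identity for `Y`
is tested against `f b`. -/
theorem HasDivergence.normalize (hY : HasDivergence μ Y fun x => n * H (F x))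
    (h : IsConformalGradient g F Y A) (hA : ContDiff ℝ 1 A) (hA' : ∀ t, HasDerivAt A (2 * H t) t)
    (hH : Continuous H) (hδ : 0 < δ) :
    HasDivergence μ (fun x => (1 / √(A (F x) + δ)) • Y x)
      fun x => H (F x) / √(A (F x) + δ) * (n - A (F x) / (A (F x) + δ)) := by
  have hpos : ∀ x, 0 < A (F x) + δ := fun x => by have := h.nonneg x; positivity
  have hF := h.contMDiff.continuous
  have hAF : Continuous fun x => A (F x) := hA.continuous.comp hF
  have hHF : Continuous fun x => H (F x) := hH.comp hF
  have hT : ∀ x, √(A (F x) + δ) ≠ 0 := fun x => (Real.sqrt_pos.2 (hpos x)).ne'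
  have hTc : Continuous fun x => √(A (F x) + δ) := by fun_prop
  have hb : Continuous fun x => 1 / √(A (F x) + δ) := continuous_const.div hTc hT
  have hdiv : Continuous fun x => H (F x) / √(A (F x) + δ) * (n - A (F x) / (A (F x) + δ)) :=
    (hHF.div hTc hT).mul (continuous_const.sub (hAF.div (by fun_prop) fun x => (hpos x).ne'))
  refine ⟨fun f hf => ?_, hdiv, fun f hf hfc => ?_⟩
  · simp only [map_smul, smul_eq_mul]
    exact hb.mul (hY.continuous_apply f hf)
  have hbd : ∀ x, HasDerivAt (fun t => 1 / √(A t + δ))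
      (-(H (F x) / (√(A (F x) + δ) * (A (F x) + δ)))) (F x) := fun x => by
    have := (((hA' (F x)).add_const δ).sqrt (hpos x).ne').inv (hT x)
    simp only [one_div]
    convert! this using 1
    rw [Real.sq_sqrt (hpos x).le]
    have := hT x
    have := (hpos x).ne'
    field_simp
  have hbC : ContMDiff (𝓡 n) 𝓘(ℝ, ℝ) 1 fun x => 1 / √(A (F x) + δ) := fun x => by
    have : ContDiffAt ℝ 1 (fun t => 1 / √(A t + δ)) (F x) :=
      contDiffAt_const.div ((hA.contDiffAt.add contDiffAt_const).sqrt (hpos x).ne') (hT x)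
    exact this.contMDiffAt.comp x (h.contMDiff x)
  have hprod : ∀ x, mvfderiv (𝓡 n) (f * fun x => 1 / √(A (F x) + δ)) x (Y x) =
      1 / √(A (F x) + δ) * mvfderiv (𝓡 n) f x (Y x) -
        f x * (H (F x) / √(A (F x) + δ) * (A (F x) / (A (F x) + δ))) := fun x => by
    rw [mvfderiv_mul (hf.mdifferentiable one_ne_zero x) (hbC.mdifferentiable one_ne_zero x)]
    rw [_root_.add_apply, _root_.smul_apply, _root_.smul_apply,
      mvfderiv_comp_of_hasDerivAt (hbd x) (h.contMDiff.mdifferentiable one_ne_zero x),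
      h.mvfderiv_eq, h.inner_self]
    have := hT x
    have := (hpos x).ne'
    simp only [smul_eq_mul]
    field_simp
    ring
  have hfb : HasCompactSupport (f * fun x => 1 / √(A (F x) + δ)) := hfc.mul_right
  have key := hY.integral_eq _ (hf.mul hbC) hfb
  have hi1 : Integrable (fun x => f x * (H (F x) / √(A (F x) + δ) * (A (F x) / (A (F x) + δ)))) μ :=
    (hf.continuous.mul ((hHF.div hTc hT).mul (hAF.div (by fun_prop)
      fun x => (hpos x).ne'))).integrable_of_hasCompactSupport hfc.mul_right
  have hi2 : Integrable (fun x => 1 / √(A (F x) + δ) * mvfderiv (𝓡 n) f x (Y x)) μ := by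
    refine (hb.mul (hY.continuous_apply f hf)).integrable_of_hasCompactSupport ?_
    refine hfc.mono' fun x hx => ?_
    by_contra h0
    exact hx (by simp [mvfderiv_eq_zero_of_notMem_tsupport h0])
  have hi3 : Integrable (fun x => (f * fun x => 1 / √(A (F x) + δ)) x * (n * H (F x))) μ :=
    ((hf.continuous.mul hb).mul (continuous_const.mul hHF)).integrable_of_hasCompactSupport
      hfb.mul_right
  simp only [hprod] at key
  rw [integral_sub hi2 hi1, sub_eq_iff_eq_add, ← integral_neg] at key
  replace key := key.trans (integral_add hi3.neg hi1).symm
  simp only [map_smul, smul_eq_mul]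
  rw [key, ← integral_neg]
  refine integral_congr_ae (.of_forall fun x => ?_)
  simp only [Pi.mul_apply, Pi.neg_apply]
  ring

/-- The ratio `A/(A + δ)` is at most one. This bounds the norm of the normalized field and leaves
the factor `n - A/(A + δ) ≥ n - 1` in its divergence. -/
theorem IsConformalGradient.ofReal_le_lambdaOne (h : IsConformalGradient g F Y A)
    (hY : HasDivergence μ Y fun x => n * H (F x)) (hA : ContDiff ℝ 1 A)
    (hA' : ∀ t, HasDerivAt A (2 * H t) t) (hH : Continuous H) (hδ : 0 < δ) {p K : ℝ} (hp : 1 < p)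
    (hn : 1 ≤ n) (hK0 : 0 ≤ K) {Ω : Set M} (hΩ : MeasurableSet Ω)
    (hK : ∀ x ∈ Ω, K ≤ H (F x) / √(A (F x) + δ)) :
    ENNReal.ofReal ((((n : ℝ) - 1) * K / p) ^ p) ≤ lambdaOne g μ p Ω := by
  have hn' : (1 : ℝ) ≤ n := by exact_mod_cast hn
  refine (hY.normalize h hA hA' hH hδ).ofReal_le_lambdaOne g hp
    (mul_nonneg (by linarith) hK0) (fun x hx => ?_) hΩ (fun x => ?_)
  · have hA0 := h.nonneg x
    have h1 : A (F x) / (A (F x) + δ) ≤ 1 := by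
      rw [div_le_one (by positivity)]
      linarith
    rw [mul_comm]
    exact mul_le_mul (hK x hx) (by linarith) (by linarith) (hK0.trans (hK x hx))
  · have hA0 := h.nonneg x
    simp only [map_smul, _root_.smul_apply, smul_eq_mul, h.inner_self]
    rw [← mul_assoc, div_mul_div_comm, Real.mul_self_sqrt (by positivity), one_mul,
      one_div_mul_eq_div, div_le_one (by positivity)]
    linarith

/-- The bound in the limit `δ → 0`. -/
theorem IsConformalGradient.ofReal_le_lambdaOne_of_mono (h : IsConformalGradient g F Y A)
    (hY : HasDivergence μ Y fun x => n * H (F x)) (hA : ContDiff ℝ 1 A)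
    (hA' : ∀ t, HasDerivAt A (2 * H t) t) (hH : Continuous H) {p t : ℝ} (hp : 1 < p)
    (hn : 1 ≤ n) (hAt : 0 < A t) (hHt : 0 ≤ H t) {Ω : Set M} (hΩ : MeasurableSet Ω)
    (hmono : ∀ᶠ δ in 𝓝[>] (0 : ℝ), ∀ x ∈ Ω, H t / √(A t + δ) ≤ H (F x) / √(A (F x) + δ)) :
    ENNReal.ofReal ((((n : ℝ) - 1) * (H t / √(A t)) / p) ^ p) ≤ lambdaOne g μ p Ω := by
  have hlim : Tendsto (fun δ => ENNReal.ofReal ((((n : ℝ) - 1) * (H t / √(A t + δ)) / p) ^ p))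
      (𝓝[>] 0) (𝓝 (ENNReal.ofReal ((((n : ℝ) - 1) * (H t / √(A t)) / p) ^ p))) := by
    refine tendsto_nhdsWithin_of_tendsto_nhds ?_
    have hc : ContinuousAt (fun δ => ENNReal.ofReal
        ((((n : ℝ) - 1) * (H t / √(A t + δ)) / p) ^ p)) 0 := by
      have h0 : √(A t + 0) ≠ 0 := by simpa using (Real.sqrt_pos.2 hAt).ne'
      refine ENNReal.continuous_ofReal.continuousAt.comp
        (ContinuousAt.rpow_const ?_ (.inr (by linarith)))
      have hs : ContinuousAt (fun δ => √(A t + δ)) 0 := by fun_prop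
      exact (continuousAt_const.mul (continuousAt_const.div hs h0)).div_const _
    simpa [ContinuousAt] using hc
  refine le_of_tendsto hlim ?_
  filter_upwards [hmono, self_mem_nhdsWithin] with δ hδ hδ0
  exact h.ofReal_le_lambdaOne hY hA hA' hH hδ0 hp hn (by positivity) hΩ hδ

end Conformal
/-! ### The divergence theorem in `ℝ^n` -/

section Euclidean

variable {n : ℕ}

theorem sum_apply_single_mul (α : EuclideanSpace ℝ (Fin n) →L[ℝ] ℝ)
    (y : EuclideanSpace ℝ (Fin n)) : ∑ i, α (EuclideanSpace.single i 1) * y i = α y := by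
  conv_rhs => rw [← (EuclideanSpace.basisFun (Fin n) ℝ).sum_repr y]
  simp [map_sum, mul_comm]

/-- Integration by parts in each coordinate, summed. The compact support of `f` makes every
integrand integrable, so `Y` need not be bounded. -/
theorem integral_fderiv_apply {Y : EuclideanSpace ℝ (Fin n) → EuclideanSpace ℝ (Fin n)}
    (hY : ContDiff ℝ 1 Y) {f : EuclideanSpace ℝ (Fin n) → ℝ} (hf : ContDiff ℝ 1 f)
    (hfc : HasCompactSupport f) :
    ∫ x, fderiv ℝ f x (Y x) = -∫ x, f x * ∑ i, fderiv ℝ Y x (EuclideanSpace.single i 1) i := by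
  have hYi : ∀ i, ContDiff ℝ 1 fun x => Y x i := fun i => by fun_prop
  have hYd : ∀ i x, fderiv ℝ (fun x => Y x i) x (EuclideanSpace.single i 1) =
      fderiv ℝ Y x (EuclideanSpace.single i 1) i := fun i x => by
    have := ((EuclideanSpace.proj i : EuclideanSpace ℝ (Fin n) →L[ℝ] ℝ).hasFDerivAt.comp x
      (hY.differentiable one_ne_zero x).hasFDerivAt).fderiv
    exact congrArg (fun L : EuclideanSpace ℝ (Fin n) →L[ℝ] ℝ =>
      L (EuclideanSpace.single i 1)) this
  have hf' : ∀ v, Continuous fun x => fderiv ℝ f x v := fun v =>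
    (hf.continuous_fderiv one_ne_zero).clm_apply continuous_const
  have hY' : ∀ i v, Continuous fun x => fderiv ℝ (fun x => Y x i) x v := fun i v =>
    ((hYi i).continuous_fderiv one_ne_zero).clm_apply continuous_const
  have hf'c : ∀ v, HasCompactSupport fun x => fderiv ℝ f x v := fun v => hfc.fderiv_apply ℝ v
  have hi1 : ∀ i, Integrable fun x => Y x i * fderiv ℝ f x (EuclideanSpace.single i 1) :=
    fun i => ((hYi i).continuous.mul (hf' _)).integrable_of_hasCompactSupport (hf'c _).mul_left
  have hi2 : ∀ i, Integrable fun x =>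
      fderiv ℝ (fun x => Y x i) x (EuclideanSpace.single i 1) * f x :=
    fun i => ((hY' i _).mul hf.continuous).integrable_of_hasCompactSupport hfc.mul_left
  calc ∫ x, fderiv ℝ f x (Y x)
      = ∫ x, ∑ i, Y x i * fderiv ℝ f x (EuclideanSpace.single i 1) := by
        simp only [mul_comm _ (fderiv ℝ f _ _), sum_apply_single_mul]
    _ = ∑ i, ∫ x, Y x i * fderiv ℝ f x (EuclideanSpace.single i 1) :=
        integral_finsetSum _ fun i _ => hi1 i
    _ = ∑ i, -∫ x, fderiv ℝ (fun x => Y x i) x (EuclideanSpace.single i 1) * f x := by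
        refine Finset.sum_congr rfl fun i _ => ?_
        exact integral_mul_fderiv_eq_neg_fderiv_mul_of_integrable (hi2 i) (hi1 i)
          (((hYi i).continuous.mul hf.continuous).integrable_of_hasCompactSupport hfc.mul_left)
          (fun x _ => (hYi i).differentiable one_ne_zero x)
          (fun x _ => hf.differentiable one_ne_zero x)
    _ = _ := by
        rw [Finset.sum_neg_distrib, ← integral_finsetSum _ fun i _ => hi2 i]
        simp_rw [Finset.mul_sum, hYd, mul_comm]

theorem mvfderiv_eq_fderiv (f : EuclideanSpace ℝ (Fin n) → ℝ) (x : EuclideanSpace ℝ (Fin n))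
    (v : TangentSpace (𝓡 n) x) : mvfderiv (𝓡 n) f x v = fderiv ℝ f x v := by
  change mfderiv (𝓡 n) 𝓘(ℝ, ℝ) f x v = fderiv ℝ f x v
  rw [mfderiv_eq_fderiv]
  rfl

/-- The divergence with respect to a measure with a `C^1` density. -/
theorem hasDivergence_withDensity {w D : EuclideanSpace ℝ (Fin n) → ℝ}
    {Y : EuclideanSpace ℝ (Fin n) → EuclideanSpace ℝ (Fin n)} (hw : ContDiff ℝ 1 w)
    (hw0 : ∀ x, 0 ≤ w x) (hY : ContDiff ℝ 1 Y) (hD : Continuous D)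
    (h : ∀ x, ∑ i, fderiv ℝ (fun x => w x • Y x) x (EuclideanSpace.single i 1) i = w x * D x) :
    HasDivergence (M := EuclideanSpace ℝ (Fin n))
      (volume.withDensity fun x => ENNReal.ofReal (w x)) Y D := by
  have hint : ∀ u : EuclideanSpace ℝ (Fin n) → ℝ,
      ∫ x, u x ∂(volume.withDensity fun x => ENNReal.ofReal (w x)) = ∫ x, w x * u x := fun u => by
    rw [integral_withDensity_eq_integral_toReal_smul
      hw.continuous.measurable.ennreal_ofReal (by simp)]
    simp_rw [ENNReal.toReal_ofReal (hw0 _), smul_eq_mul]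
  refine ⟨fun f hf => ?_, hD, fun f hf hfc => ?_⟩
  · exact (((contMDiff_iff_contDiff.1 hf).continuous_fderiv one_ne_zero).clm_apply
      hY.continuous).congr fun x => (mvfderiv_eq_fderiv f x (Y x)).symm
  -- The divergence for the measure `w dx` is `w⁻¹ div(wY)`, so the Lebesgue formula is applied to
  -- `wY`.
  · have key := integral_fderiv_apply (hw.smul hY) (contMDiff_iff_contDiff.1 hf) hfc
    refine (integral_congr_ae (.of_forall fun x => mvfderiv_eq_fderiv f x (Y x))).trans ?_
    rw [hint, hint]
    refine Eq.trans (by simp) (key.trans (congrArg Neg.neg (integral_congr_ae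
      (.of_forall fun x => ?_))))
    exact (congrArg (f x * ·) (h x)).trans (mul_left_comm _ _ _)

end Euclidean

/-! ### The hyperbolic space -/

section Hyperbolic

variable {n : ℕ} {c : ℝ}

theorem hypHeight_pos (hc : c < 0) (x : EuclideanSpace ℝ (Fin n)) : 0 < hypHeight n c x := by
  have : 0 < (-c)⁻¹ := inv_pos.2 (neg_pos.2 hc)
  exact Real.sqrt_pos.2 (by positivity)

theorem hypHeight_sq (hc : c < 0) (x : EuclideanSpace ℝ (Fin n)) :
    hypHeight n c x ^ 2 = (-c)⁻¹ + ‖x‖ ^ 2 := by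
  have : 0 < (-c)⁻¹ := inv_pos.2 (neg_pos.2 hc)
  exact Real.sq_sqrt (by positivity)

theorem contDiff_hypHeight (hc : c < 0) : ContDiff ℝ 1 (hypHeight n c) := by
  have h : 0 < (-c)⁻¹ := inv_pos.2 (neg_pos.2 hc)
  refine ContDiff.sqrt (contDiff_const.add (contDiff_norm_sq ℝ)) fun x => ?_
  positivity

/-- The Gram matrix is the identity minus the rank-one matrix `x xᵀ / h²`, with `h` the height. The
matrix determinant lemma gives `1 - |x|²/h²`, which the equation of the sheet turns into `1 / (-c
h²)`. -/
theorem hypVolume_eq (hc : c < 0) : hypVolume n c =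
    (volume : Measure (EuclideanSpace ℝ (Fin n))).withDensity fun x =>
      ENNReal.ofReal (√(-c) * hypHeight n c x)⁻¹ := by
  unfold hypVolume
  congr 1
  ext x
  congr 1
  have hh := hypHeight_pos hc x
  have hdet : Matrix.det (Matrix.of fun i j : Fin n =>
      hypForm n c x (EuclideanSpace.single i 1) (EuclideanSpace.single j 1)) =
      1 - ‖x‖ ^ 2 / hypHeight n c x ^ 2 := by
    have e : (Matrix.of fun i j : Fin n =>
        hypForm n c x (EuclideanSpace.single i 1) (EuclideanSpace.single j 1)) =
        1 + Matrix.replicateCol Unit (fun i => -(x i / hypHeight n c x ^ 2)) *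
          Matrix.replicateRow Unit (fun j => x j) := by
      ext i j
      rw [Matrix.of_apply, hypForm_apply, (hasFDerivAt_hypHeight hc x).fderiv]
      simp [Matrix.mul_apply, Matrix.one_apply, EuclideanSpace.inner_single_right]
      simp only [eq_comm (a := j)]
      ring
    rw [e, Matrix.det_one_add_replicateCol_mul_replicateRow]
    rw [EuclideanSpace.norm_sq_eq, dotProduct, Finset.sum_div, sub_eq_add_neg,
      ← Finset.sum_neg_distrib]
    congr 1
    refine Finset.sum_congr rfl fun i _ => ?_
    rw [Real.norm_eq_abs, sq_abs]
    ring
  have h2 := hypHeight_sq hc x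
  have : 1 - ‖x‖ ^ 2 / hypHeight n c x ^ 2 = ((√(-c) * hypHeight n c x)⁻¹) ^ 2 := by
    rw [inv_pow, mul_pow, Real.sq_sqrt (by linarith), one_sub_div (by positivity),
      div_eq_iff (by positivity), mul_inv, mul_assoc, inv_mul_cancel₀ (by positivity), mul_one,
      h2, add_sub_cancel_right]
  rw [hdet, this, Real.sqrt_sq (by positivity)]

/-- The hyperbolic cosine of `√(-c)` times the distance to `q`. -/
noncomputable def hypCosh (n : ℕ) (c : ℝ) (q x : EuclideanSpace ℝ (Fin n)) : ℝ :=
  -c * (hypHeight n c q * hypHeight n c x - inner ℝ q x)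

/-- The gradient of `hypCosh n c q`. -/
noncomputable def hypGrad (n : ℕ) (c : ℝ) (q x : EuclideanSpace ℝ (Fin n)) :
    EuclideanSpace ℝ (Fin n) :=
  -c • (hypCosh n c q x • x - q)

theorem hasFDerivAt_hypCosh (hc : c < 0) (q x : EuclideanSpace ℝ (Fin n)) :
    HasFDerivAt (hypCosh n c q)
      (-c • ((hypHeight n c q * (hypHeight n c x)⁻¹) • innerSL ℝ x - innerSL ℝ q)) x := by
  have h1 := (hasFDerivAt_hypHeight hc x).const_mul (hypHeight n c q)
  have h2 : HasFDerivAt (fun y => (inner ℝ q y : ℝ)) (innerSL ℝ q) x := (innerSL ℝ q).hasFDerivAt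
  have := (h1.sub h2).const_mul (-c)
  rwa [smul_smul] at this

theorem contDiff_hypCosh (hc : c < 0) (q : EuclideanSpace ℝ (Fin n)) :
    ContDiff ℝ 1 (hypCosh n c q) :=
  contDiff_const.mul ((contDiff_const.mul (contDiff_hypHeight hc)).sub
    (contDiff_const.inner ℝ contDiff_id))

theorem inner_eq_hypCosh (hc : c < 0) (q x : EuclideanSpace ℝ (Fin n)) :
    inner ℝ q x = hypHeight n c q * hypHeight n c x - hypCosh n c q x * (-c)⁻¹ := by
  have : c ≠ 0 := hc.ne
  unfold hypCosh
  field_simp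
  ring

theorem inner_hypGrad (hc : c < 0) (q x : EuclideanSpace ℝ (Fin n)) :
    inner ℝ x (hypGrad n c q x) =
      -c * hypHeight n c x * (hypCosh n c q x * hypHeight n c x - hypHeight n c q) := by
  have hc0 : c ≠ 0 := hc.ne
  rw [hypGrad, inner_smul_right, inner_sub_right, inner_smul_right, real_inner_self_eq_norm_sq,
    ← sub_eq_iff_eq_add'.2 (hypHeight_sq hc x), real_inner_comm, inner_eq_hypCosh hc]
  field_simp
  ring

/-- On the hyperboloid the function is `c` times the Minkowski product with a fixed point `Q` of the
sheet, hence the restriction of a linear function. Its gradient at `X` is the tangential part `-c (F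
X - Q)` of the constant vector `cQ`, and `hypGrad` is the `ℝ^n` component of this. -/
theorem isConformalGradient_hypCosh (hc : c < 0) (q : EuclideanSpace ℝ (Fin n)) :
    IsConformalGradient (hypMetric n c hc) (hypCosh n c q) (hypGrad n c q)
      fun t => -c * (t ^ 2 - 1) := by
  -- The right side is the differential of `hypCosh` applied to `v`. Taking `v` to be the gradient
  -- then yields the squared norm.
  have key : ∀ x v : EuclideanSpace ℝ (Fin n), hypForm n c x (hypGrad n c q x) v =
      -c * (hypHeight n c q * (hypHeight n c x)⁻¹ * inner ℝ x v - inner ℝ q v) := fun x v => by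
    have hc0 : c ≠ 0 := hc.ne
    have hh0 := (hypHeight_pos hc x).ne'
    rw [hypForm_apply, (hasFDerivAt_hypHeight hc x).fderiv]
    simp only [_root_.smul_apply, innerSL_apply_apply, smul_eq_mul, inner_hypGrad hc]
    rw [hypGrad, real_inner_smul_left, inner_sub_left, real_inner_smul_left]
    field_simp
    ring
  refine ⟨(contDiff_hypCosh hc q).contMDiff, fun x v => ?_, fun x => ?_⟩
  · refine (mvfderiv_eq_fderiv _ x v).trans ?_
    rw [(hasFDerivAt_hypCosh hc q x).fderiv]
    exact (key x v).symm
  · refine (key x _).trans ?_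
    have hc0 : c ≠ 0 := hc.ne
    have hh0 := (hypHeight_pos hc x).ne'
    have h1 : inner ℝ q (hypGrad n c q x) = -c * (hypCosh n c q x *
        (hypHeight n c q * hypHeight n c x - hypCosh n c q x * (-c)⁻¹) -
          (hypHeight n c q ^ 2 - (-c)⁻¹)) := by
      rw [hypGrad, inner_smul_right, inner_sub_right, inner_smul_right,
        real_inner_self_eq_norm_sq, sub_eq_iff_eq_add'.2 (hypHeight_sq hc q),
        inner_eq_hypCosh hc]
    rw [h1, inner_hypGrad hc]
    field_simp
    ring

theorem hasDivergence_hypGrad (hc : c < 0) (q : EuclideanSpace ℝ (Fin n)) :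
    HasDivergence (M := EuclideanSpace ℝ (Fin n)) (hypVolume n c) (hypGrad n c q)
      fun x => n * (-c * hypCosh n c q x) := by
  rw [hypVolume_eq hc]
  have hh := contDiff_hypHeight (n := n) hc
  have hF := contDiff_hypCosh hc q
  have hpos : ∀ x, √(-c) * hypHeight n c x ≠ 0 := fun x =>
    (mul_pos (Real.sqrt_pos.2 (by linarith)) (hypHeight_pos hc x)).ne'
  have hwd := (contDiff_const (c := √(-c))).mul hh
  refine hasDivergence_withDensity (hwd.inv hpos) (fun x => ?_)
    (((hF.smul contDiff_id).sub contDiff_const).const_smul (-c))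
    (continuous_const.mul (continuous_const.mul hF.continuous)) (fun x => ?_)
  · have := hypHeight_pos hc x
    positivity
  have hw' := (hasDerivAt_inv (hpos x)).comp_hasFDerivAt x
    ((hasFDerivAt_hypHeight hc x).const_mul (√(-c)))
  set β := -((√(-c) * hypHeight n c x) ^ 2)⁻¹ • √(-c) • (hypHeight n c x)⁻¹ • innerSL ℝ x
  have hF' := hasFDerivAt_hypCosh hc q x
  set α := -c • ((hypHeight n c q * (hypHeight n c x)⁻¹) • innerSL ℝ x - innerSL ℝ q)
  have hY' := ((hF'.smul (hasFDerivAt_id x)).sub_const q).const_smul (-c)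
  have hZ := (hw'.smul hY').fderiv
  refine (Finset.sum_congr rfl fun i _ => congrArg (fun L : EuclideanSpace ℝ (Fin n) →L[ℝ]
    EuclideanSpace ℝ (Fin n) => L (EuclideanSpace.single i 1) i) hZ).trans ?_
  -- The product rule gives three terms. Summed over `i`, the first is the claimed density times
  -- divergence. The other two, from differentiating `hypCosh` and the density, cancel.
  refine (Finset.sum_congr rfl fun i _ => show _ = (√(-c) * hypHeight n c x)⁻¹ *
      (-c * hypCosh n c q x) +
      (√(-c) * hypHeight n c x)⁻¹ * -c * (α (EuclideanSpace.single i 1) * x i) +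
      β (EuclideanSpace.single i 1) * hypGrad n c q x i from ?_).trans ?_
  · simp [hypGrad]
    ring
  rw [Finset.sum_add_distrib, Finset.sum_add_distrib, Finset.sum_const, ← Finset.mul_sum,
    sum_apply_single_mul, sum_apply_single_mul]
  have hβY : β (hypGrad n c q x) = -((√(-c) * hypHeight n c x) ^ 2)⁻¹ * (√(-c) *
      ((hypHeight n c x)⁻¹ * inner ℝ x (hypGrad n c q x))) := by
    simp [β]
  have hαx : α x = hypCosh n c q x - hypHeight n c q / hypHeight n c x := by
    have hc0 : c ≠ 0 := hc.ne
    have hh0 := (hypHeight_pos hc x).ne'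
    simp only [α, _root_.smul_apply, _root_.sub_apply, innerSL_apply_apply, smul_eq_mul]
    rw [inner_eq_hypCosh hc q x, real_inner_self_eq_norm_sq,
      ← sub_eq_iff_eq_add'.2 (hypHeight_sq hc x)]
    field_simp
    ring
  rw [hβY, hαx, inner_hypGrad hc]
  have hh0 := (hypHeight_pos hc x).ne'
  have hs0 : √(-c) ≠ 0 := (Real.sqrt_pos.2 (by linarith)).ne'
  simp only [Finset.card_univ, Fintype.card_fin, nsmul_eq_mul]
  field_simp
  ring

end Hyperbolic
-- Distance comparison and eigenvalue bound in hyperbolic space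
section Hyperbolic

variable {n : ℕ} {c : ℝ}

/-- Nonnegativity of the squared gradient norm `-c (F² - 1)` gives `F² ≥ 1`, and Cauchy–Schwarz with
`‖y‖ ≤ hypHeight n c y` gives `F ≥ 0`. -/
theorem one_le_hypCosh (hc : c < 0) (q x : EuclideanSpace ℝ (Fin n)) : 1 ≤ hypCosh n c q x := by
  have h1 := (isConformalGradient_hypCosh hc q).nonneg x
  have hle : ∀ y : EuclideanSpace ℝ (Fin n), ‖y‖ ≤ hypHeight n c y := fun y => by
    have : 0 < (-c)⁻¹ := inv_pos.2 (neg_pos.2 hc)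
    exact Real.le_sqrt_of_sq_le (by linarith)
  have h2 : 0 ≤ hypCosh n c q x := by
    refine mul_nonneg (by linarith) (sub_nonneg.2 ((real_inner_le_norm q x).trans ?_))
    exact mul_le_mul (hle q) (hle x) (norm_nonneg _) (hypHeight_pos hc q).le
  have h3 : 0 ≤ hypCosh n c q x ^ 2 - 1 := nonneg_of_mul_nonneg_right h1 (by linarith)
  nlinarith

theorem hypCosh_self (hc : c < 0) (q : EuclideanSpace ℝ (Fin n)) : hypCosh n c q q = 1 := by
  have : -c ≠ 0 := by linarith
  rw [hypCosh, real_inner_self_eq_norm_sq, ← sq, hypHeight_sq hc, add_sub_cancel_right,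
    mul_inv_cancel₀ this]

/-- The function `G δ` is a primitive of `1 / √(-c (t² - 1) - c δ)`, and at `δ = 0` it is `arcosh t
/ √(-c)`. The limit `δ → 0` bounds `arcosh (hypCosh n c q x)` by `√(-c) R`. -/
theorem hypCosh_le_of_mem_geodesicBall (hc : c < 0) {q x : EuclideanSpace ℝ (Fin n)} {R : ℝ}
    (hR : 0 < R) (hx : x ∈ geodesicBall (hypMetric n c hc) q R) :
    hypCosh n c q x ≤ Real.cosh (√(-c) * R) := by
  have hs : 0 < √(-c) := Real.sqrt_pos.2 (by linarith)
  set G : ℝ → ℝ → ℝ := fun δ t => Real.log (t + √(t ^ 2 - 1 + δ)) / √(-c) with hGdef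
  have hlt : ∀ δ > 0, G δ (hypCosh n c q x) - G δ (hypCosh n c q q) < R := fun δ hδ => by
    have hpos : ∀ y, 0 < hypCosh n c q y ^ 2 - 1 + δ := fun y => by
      have := one_le_hypCosh hc q y
      nlinarith
    refine (isConformalGradient_hypCosh hc q).sub_lt (δ := -c * δ) (by nlinarith) (G := G δ)
      (fun y => ?_) (fun y => ?_) hx
    · have h1 := one_le_hypCosh hc q y
      have h2 := Real.sqrt_nonneg (hypCosh n c q y ^ 2 - 1 + δ)
      have h3 : ContDiffAt ℝ 1 (fun t : ℝ => t ^ 2 - 1 + δ) (hypCosh n c q y) := by fun_prop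
      refine ContDiffAt.div_const (ContDiffAt.log (contDiffAt_id.add
        (h3.sqrt (hpos y).ne')) ?_) _
      exact (add_pos_of_pos_of_nonneg (by simp; linarith) h2).ne'
    · have h1 := one_le_hypCosh hc q y
      have hp := hpos y
      have h2 := Real.sqrt_pos.2 hp
      have hd : HasDerivAt (fun t : ℝ => t ^ 2 - 1 + δ) (2 * hypCosh n c q y)
          (hypCosh n c q y) := by
        simpa using ((hasDerivAt_pow 2 (hypCosh n c q y)).sub_const 1).add_const δ
      have := (((hasDerivAt_id (hypCosh n c q y)).add (hd.sqrt hp.ne')).log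
        (add_pos_of_pos_of_nonneg (by simp; linarith) h2.le).ne').div_const (√(-c))
      convert! this using 1
      rw [← mul_add, Real.sqrt_mul (by linarith)]
      have h3 : hypCosh n c q y + √(hypCosh n c q y ^ 2 - 1 + δ) ≠ 0 := by positivity
      simp only [id, Pi.add_apply]
      field_simp
      ring
  have hcont : ∀ y, Tendsto (fun δ => G δ (hypCosh n c q y)) (𝓝[>] 0)
      (𝓝 (G 0 (hypCosh n c q y))) := fun y => by
    refine tendsto_nhdsWithin_of_tendsto_nhds ?_
    have h1 := one_le_hypCosh hc q y
    have : ContinuousAt (fun δ => G δ (hypCosh n c q y)) 0 := by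
      refine ContinuousAt.div_const (ContinuousAt.log (by fun_prop) ?_) _
      positivity
    exact this
  have hle : G 0 (hypCosh n c q x) - G 0 (hypCosh n c q q) ≤ R :=
    le_of_tendsto ((hcont x).sub (hcont q)) (by
      filter_upwards [self_mem_nhdsWithin] with δ hδ using (hlt δ hδ).le)
  have h1 : G 0 (hypCosh n c q q) = 0 := by simp [hGdef, hypCosh_self hc]
  have h2 : Real.arcosh (hypCosh n c q x) ≤ √(-c) * R := by
    rw [h1, sub_zero] at hle
    simp only [hGdef, add_zero] at hle
    rw [div_le_iff₀ hs, mul_comm] at hle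
    exact hle
  rw [← Real.cosh_arcosh (one_le_hypCosh hc q x), Real.cosh_le_cosh,
    abs_of_nonneg (Real.arcosh_nonneg (one_le_hypCosh hc q x)), abs_of_pos (by positivity)]
  exact h2

theorem isFiniteMeasureOnCompacts_hypVolume (hc : c < 0) :
    IsFiniteMeasureOnCompacts (hypVolume n c) := by
  have hs : 0 < √(-c) := Real.sqrt_pos.2 (by linarith)
  rw [hypVolume_eq hc]
  have : Continuous fun x : EuclideanSpace ℝ (Fin n) => (√(-c) * hypHeight n c x)⁻¹ :=
    (continuous_const.mul (contDiff_hypHeight hc).continuous).inv₀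
      fun x => (mul_pos hs (hypHeight_pos hc x)).ne'
  have := IsLocallyFiniteMeasure.withDensity_ofReal (μ := volume) this
  infer_instance

theorem ofReal_le_lambdaOne_hypMetric (hn : 1 ≤ n) {p : ℝ} (hp : 1 < p) (hc : c < 0) {R : ℝ}
    (hR : 0 < R) {q : EuclideanSpace ℝ (Fin n)} {Ω : Set (EuclideanSpace ℝ (Fin n))}
    (hΩ : IsOpen Ω) (hsub : Ω ⊆ geodesicBall (hypMetric n c hc) q R) :
    ENNReal.ofReal ((((n : ℝ) - 1) * √(-c) / p) ^ p *
        (Real.cosh (√(-c) * R) / Real.sinh (√(-c) * R)) ^ p) ≤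
      lambdaOne (hypMetric n c hc) (hypVolume n c) p Ω := by
  have := isFiniteMeasureOnCompacts_hypVolume (n := n) hc
  have hs : 0 < √(-c) := Real.sqrt_pos.2 (by linarith)
  have hsR : 0 < √(-c) * R := by positivity
  have hsinh := Real.sinh_pos_iff.2 hsR
  have hcosh := Real.cosh_pos (√(-c) * R)
  have hcs := Real.cosh_sq (√(-c) * R)
  have hn' : (1 : ℝ) ≤ n := by exact_mod_cast hn
  have hA : -c * (Real.cosh (√(-c) * R) ^ 2 - 1) = (√(-c) * Real.sinh (√(-c) * R)) ^ 2 := by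
    rw [mul_pow, Real.sq_sqrt (by linarith), hcs]
    ring
  have key := (isConformalGradient_hypCosh hc q).ofReal_le_lambdaOne_of_mono
    (H := fun t => -c * t) (hasDivergence_hypGrad hc q) (by fun_prop)
    (fun t => by
      convert! ((hasDerivAt_pow 2 t).sub_const 1).const_mul (-c) using 1
      push_cast
      ring) (by fun_prop) hp hn
    (t := Real.cosh (√(-c) * R)) (by rw [hA]; positivity)
    (mul_nonneg (by linarith) hcosh.le) hΩ.measurableSet ?_
  · refine le_trans (le_of_eq ?_) key
    rw [hA, Real.sqrt_sq (by positivity), ← Real.mul_rpow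
      (div_nonneg (mul_nonneg (by linarith) hs.le) (by linarith)) (by positivity)]
    have h1 : √(-c) * √(-c) = -c := Real.mul_self_sqrt (by linarith)
    have h2 : -c * Real.cosh (√(-c) * R) / (√(-c) * Real.sinh (√(-c) * R)) =
        √(-c) * (Real.cosh (√(-c) * R) / Real.sinh (√(-c) * R)) := by
      rw [div_eq_iff (by positivity), mul_mul_mul_comm, h1, div_mul_cancel₀ _ hsinh.ne']
    rw [h2]
    congr 2
    ring
  -- With `k = -c`, the square of the quotient is `k² t² / (k t² - (k - δ))`, which decreases in `t`
  -- as long as `δ ≤ k`. This is why `δ` is kept below `-c`.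
  · filter_upwards [Ioo_mem_nhdsGT (by linarith : 0 < -c)] with δ hδ x hx
    have h1 := one_le_hypCosh hc q x
    have h2 := hypCosh_le_of_mem_geodesicBall hc hR (hsub hx)
    have hp1 : 0 < -c * (Real.cosh (√(-c) * R) ^ 2 - 1) + δ := by
      rw [hA]; have := hδ.1; positivity
    have hp2 : 0 < -c * (hypCosh n c q x ^ 2 - 1) + δ := by
      have := hδ.1
      have : 0 ≤ -c * (hypCosh n c q x ^ 2 - 1) := mul_nonneg (by linarith) (by nlinarith)
      linarith
    rw [mul_div_assoc, mul_div_assoc]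
    refine mul_le_mul_of_nonneg_left ?_ (by linarith)
    refine (sq_le_sq₀ (by positivity) (by positivity)).1 ?_
    rw [div_pow, div_pow, Real.sq_sqrt hp1.le, Real.sq_sqrt hp2.le, div_le_div_iff₀ hp1 hp2]
    have h3 : hypCosh n c q x ^ 2 ≤ Real.cosh (√(-c) * R) ^ 2 := by gcongr
    nlinarith [hδ.2]

end Hyperbolic

/-! ### The Euclidean space -/

section Flat

variable {n : ℕ}

theorem isConformalGradient_half_norm_sub_sq (q : EuclideanSpace ℝ (Fin n)) :
    IsConformalGradient (euclideanMetric n) (fun x => ‖x - q‖ ^ 2 / 2) (fun x => x - q)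
      fun t => 2 * t := by
  refine ⟨(((contDiff_id.sub contDiff_const).norm_sq ℝ).div_const 2).contMDiff, fun x v => ?_,
    fun x => ?_⟩
  · have h : HasFDerivAt (fun y : EuclideanSpace ℝ (Fin n) => ‖y - q‖ ^ 2 / 2)
        (innerSL ℝ (x - q)) x := by
      have := ((hasStrictFDerivAt_norm_sq (x - q)).hasFDerivAt.comp x
        ((hasFDerivAt_id x).sub_const q)).const_mul (2 : ℝ)⁻¹
      simp only [div_eq_inv_mul]
      convert! this using 1
      ext v
      simp
    refine (mvfderiv_eq_fderiv _ x v).trans ?_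
    rw [h.fderiv]
    rfl
  · exact (real_inner_self_eq_norm_sq (x - q)).trans (by ring)

theorem hasDivergence_sub_const (q : EuclideanSpace ℝ (Fin n)) :
    HasDivergence (M := EuclideanSpace ℝ (Fin n)) volume (fun x => x - q) fun _ => n * 1 := by
  have := hasDivergence_withDensity (n := n) (w := fun _ => 1) (D := fun _ => n * 1)
    (Y := fun x => x - q) (by fun_prop) (by simp) (by fun_prop) (by fun_prop)
    (fun x => by simp [fderiv_sub_const])
  simpa using this

/-- Here the primitive of `1 / √(2t + δ)` is `√(2t + δ)`, which at `t = ‖x - q‖²/2` tends to `‖x -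
q‖` as `δ → 0`. -/
theorem norm_sub_le_of_mem_geodesicBall {q x : EuclideanSpace ℝ (Fin n)} {R : ℝ}
    (hx : x ∈ geodesicBall (euclideanMetric n) q R) : ‖x - q‖ ≤ R := by
  have hlt : ∀ δ > 0, √(2 * (‖x - q‖ ^ 2 / 2) + δ) - √(2 * (‖q - q‖ ^ 2 / 2) + δ) < R :=
    fun δ hδ => by
      refine (isConformalGradient_half_norm_sub_sq q).sub_lt hδ (G := fun t => √(2 * t + δ))
        (fun y => ContDiffAt.sqrt (by fun_prop) (by positivity)) (fun y => ?_) hx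
      have := (((hasDerivAt_id (‖y - q‖ ^ 2 / 2)).const_mul 2).add_const δ).sqrt
        (by simp only [id]; positivity)
      convert! this using 1
      simp only [id]
      field_simp
  have hlim : Tendsto (fun δ => √(2 * (‖x - q‖ ^ 2 / 2) + δ) - √(2 * (‖q - q‖ ^ 2 / 2) + δ))
      (𝓝[>] 0) (𝓝 ‖x - q‖) := by
    refine tendsto_nhdsWithin_of_tendsto_nhds ?_
    have : Continuous fun δ => √(2 * (‖x - q‖ ^ 2 / 2) + δ) - √(2 * (‖q - q‖ ^ 2 / 2) + δ) := by
      fun_prop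
    convert! this.tendsto 0 using 2
    simp [mul_div_cancel₀]
  refine le_of_tendsto hlim ?_
  filter_upwards [self_mem_nhdsWithin] with δ hδ using (hlt δ hδ).le

theorem ofReal_le_lambdaOne_euclideanMetric (hn : 1 ≤ n) {p : ℝ} (hp : 1 < p) {R : ℝ}
    (hR : 0 < R) {q : EuclideanSpace ℝ (Fin n)} {Ω : Set (EuclideanSpace ℝ (Fin n))}
    (hΩ : IsOpen Ω) (hsub : Ω ⊆ geodesicBall (euclideanMetric n) q R) :
    ENNReal.ofReal (((n : ℝ) - 1) ^ p / (p ^ p * R ^ p)) ≤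
      lambdaOne (euclideanMetric n) volume p Ω := by
  have hn' : (1 : ℝ) ≤ n := by exact_mod_cast hn
  have key := (isConformalGradient_half_norm_sub_sq q).ofReal_le_lambdaOne_of_mono
    (H := fun _ => 1) (hasDivergence_sub_const q) (by fun_prop)
    (fun t => by simpa using (hasDerivAt_id t).const_mul 2) (by fun_prop) hp hn
    (t := R ^ 2 / 2) (by positivity) zero_le_one hΩ.measurableSet ?_
  · refine le_trans (le_of_eq ?_) key
    rw [mul_div_cancel₀ _ two_ne_zero, Real.sqrt_sq hR.le, ← Real.mul_rpow (by linarith) hR.le,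
      ← Real.div_rpow (by linarith) (by positivity)]
    congr 2
    field_simp
  -- Since `H = 1`, only the denominator varies, and it increases with `‖x - q‖ ≤ R`.
  · filter_upwards [self_mem_nhdsWithin] with δ hδ x hx
    have h1 := norm_sub_le_of_mem_geodesicBall (hsub hx)
    have hδ' : 0 < δ := hδ
    gcongr

end Flat
/-! ### The sphere -/

section Sphere

variable {n : ℕ}

theorem norm_sph (x : Sph n) : ‖(x : EuclideanSpace ℝ (Fin (n + 1)))‖ = 1 :=
  norm_eq_of_mem_sphere x

theorem exists_dIncl_eq (x : Sph n) {w : EuclideanSpace ℝ (Fin (n + 1))}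
    (hw : inner ℝ (x : EuclideanSpace ℝ (Fin (n + 1))) w = 0) : ∃ v, dIncl n x v = w := by
  have : Fact (Module.finrank ℝ (EuclideanSpace ℝ (Fin (n + 1))) = n + 1) :=
    ⟨finrank_euclideanSpace_fin⟩
  have h : w ∈ (dIncl n x).range := by
    unfold dIncl
    rw [range_mvfderiv_subtypeVal x, Submodule.mem_orthogonal_singleton_iff_inner_right]
    exact hw
  exact h

theorem inner_dIncl (x : Sph n) (v : TangentSpace (𝓡 n) x) :
    inner ℝ (x : EuclideanSpace ℝ (Fin (n + 1))) (dIncl n x v) = 0 := by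
  have : Fact (Module.finrank ℝ (EuclideanSpace ℝ (Fin (n + 1))) = n + 1) :=
    ⟨finrank_euclideanSpace_fin⟩
  rw [← Submodule.mem_orthogonal_singleton_iff_inner_right]
  exact (range_mvfderiv_subtypeVal x).le ⟨v, rfl⟩

/-- Integration in polar coordinates of a product of an angular and a radial function. -/
theorem integral_eq_toSphere_mul {G : EuclideanSpace ℝ (Fin (n + 1)) → ℝ} {a : Sph n → ℝ}
    {b : ℝ → ℝ} (hG : ∀ (x : Sph n) (r : ℝ), 0 < r →
      G (r • (x : EuclideanSpace ℝ (Fin (n + 1)))) = a x * b r) :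
    ∫ y, G y = (∫ x, a x ∂(volume : Measure (EuclideanSpace ℝ (Fin (n + 1)))).toSphere) *
      ∫ r : Ioi (0 : ℝ), b r ∂Measure.volumeIoiPow
        (Module.finrank ℝ (EuclideanSpace ℝ (Fin (n + 1))) - 1) := by
  rw [← integral_prod_mul, ← (Measure.measurePreserving_homeomorphUnitSphereProd
    (volume : Measure (EuclideanSpace ℝ (Fin (n + 1))))).integral_comp
    (Homeomorph.measurableEmbedding _)]
  conv_lhs => rw [← restrict_compl_singleton (μ := volume) (0 : EuclideanSpace ℝ (Fin (n + 1)))]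
  rw [← integral_subtype_comap (measurableSet_singleton _).compl]
  refine integral_congr_ae (.of_forall fun y => ?_)
  have hy : 0 < ‖(y : EuclideanSpace ℝ (Fin (n + 1)))‖ := norm_pos_iff.2 y.2
  have := hG (homeomorphUnitSphereProd _ y).1 (homeomorphUnitSphereProd _ y).2
    (homeomorphUnitSphereProd _ y).2.2
  refine Eq.trans (congrArg G ?_) this
  simp [smul_smul, hy.ne']

/-- The radial projection to the sphere (with value `q` at the origin). -/
noncomputable def sphProj (q : Sph n) (y : EuclideanSpace ℝ (Fin (n + 1))) : Sph n :=
  if h : y = 0 then q else ⟨‖y‖⁻¹ • y, by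
    rw [mem_sphere_zero_iff_norm, norm_smul, norm_inv, norm_norm,
      inv_mul_cancel₀ (norm_ne_zero_iff.2 h)]⟩

theorem sphProj_coe (q x : Sph n) : sphProj q x = x := by
  have h : (x : EuclideanSpace ℝ (Fin (n + 1))) ≠ 0 := ne_zero_of_mem_unit_sphere x
  rw [sphProj, dif_neg h]
  ext1
  simp

theorem sphProj_smul (q : Sph n) {r : ℝ} (hr : 0 < r) (y : EuclideanSpace ℝ (Fin (n + 1))) :
    sphProj q (r • y) = sphProj q y := by
  rcases eq_or_ne y 0 with rfl | hy
  · rw [smul_zero]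
  rw [sphProj, sphProj, dif_neg hy, dif_neg (smul_ne_zero hr.ne' hy)]
  ext1
  simp only [norm_smul, Real.norm_of_nonneg hr.le, mul_inv, smul_smul]
  congr 1
  field_simp

/-- Smoothness of a map into the sphere is obtained by restricting the codomain of a globally smooth
map. Hence the identity is replaced by a nowhere vanishing smooth map `h` that agrees with it near
`y₀`, and `h / ‖h‖` is used. -/
theorem contDiffAt_comp_sphProj (q : Sph n) {f : Sph n → ℝ}
    (hf : ContMDiff (𝓡 n) 𝓘(ℝ, ℝ) 1 f) {y₀ : EuclideanSpace ℝ (Fin (n + 1))} (hy₀ : y₀ ≠ 0) :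
    ContDiffAt ℝ 1 (fun y => f (sphProj q y)) y₀ := by
  have : Fact (Module.finrank ℝ (EuclideanSpace ℝ (Fin (n + 1))) = n + 1) :=
    ⟨finrank_euclideanSpace_fin⟩
  have hpos : 0 < ‖y₀‖ := norm_pos_iff.2 hy₀
  let χ : ContDiffBump y₀ := ⟨‖y₀‖ / 2, ‖y₀‖, by linarith, by linarith⟩
  let h : EuclideanSpace ℝ (Fin (n + 1)) → EuclideanSpace ℝ (Fin (n + 1)) :=
    fun y => y₀ + χ y • (y - y₀)
  have hχ : ContDiff ℝ 1 χ := χ.contDiff (n := 1)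
  have hh : ContDiff ℝ 1 h := contDiff_const.add (hχ.smul (contDiff_id.sub contDiff_const))
  -- A zero of `h` would need `χ y ‖y - y₀‖ = ‖y₀‖`. This fails inside the ball of radius `‖y₀‖`,
  -- where `χ ≤ 1`, and outside it, where `χ = 0`.
  have hh0 : ∀ y, h y ≠ 0 := fun y hy => by
    have h1 : ‖χ y • (y - y₀)‖ = ‖y₀‖ := by
      rw [← norm_neg, ← eq_neg_iff_add_eq_zero.2 hy]
    rw [norm_smul, Real.norm_of_nonneg χ.nonneg] at h1
    rcases lt_or_ge (dist y y₀) ‖y₀‖ with h2 | h2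
    · rw [dist_eq_norm] at h2
      have := mul_le_mul_of_nonneg_right (χ.le_one (x := y)) (norm_nonneg (y - y₀))
      linarith
    · rw [χ.zero_of_le_dist h2, zero_mul] at h1
      exact hpos.ne h1
  have hN : ContDiff ℝ 1 fun y => ‖h y‖⁻¹ • h y :=
    ((hh.norm ℝ hh0).inv fun y => norm_ne_zero_iff.2 (hh0 y)).smul hh
  have hmem : ∀ y, ‖h y‖⁻¹ • h y ∈ Metric.sphere (0 : EuclideanSpace ℝ (Fin (n + 1))) 1 :=
    fun y => by
      rw [mem_sphere_zero_iff_norm, norm_smul, norm_inv, norm_norm,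
        inv_mul_cancel₀ (norm_ne_zero_iff.2 (hh0 y))]
  have hcod := hN.contMDiff.codRestrict_sphere (n := n) hmem
  have hc : ContDiff ℝ 1 fun y => f (codRestrict _ _ hmem y) :=
    contMDiff_iff_contDiff.1 (hf.comp hcod)
  refine hc.contDiffAt.congr_of_eventuallyEq ?_
  filter_upwards [χ.eventuallyEq_one, isOpen_ne.mem_nhds hy₀] with y hy hy0
  have h1 : h y = y := by simp [h, hy]
  congr 1
  rw [sphProj, dif_neg hy0]
  ext1
  simp [h1]

/-- The conformal vector field `y ↦ ⟨q, y⟩ y - |y|² q`, tangent to all spheres. -/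
theorem integral_fderiv_conformal (q : EuclideanSpace ℝ (Fin (n + 1)))
    {f : EuclideanSpace ℝ (Fin (n + 1)) → ℝ} (hf : ContDiff ℝ 1 f) (hfc : HasCompactSupport f) :
    ∫ y, fderiv ℝ f y ((inner ℝ q y : ℝ) • y - ‖y‖ ^ 2 • q) =
      -∫ y, f y * (n * inner ℝ q y) := by
  have hY : ContDiff ℝ 1 fun y : EuclideanSpace ℝ (Fin (n + 1)) =>
      (inner ℝ q y : ℝ) • y - ‖y‖ ^ 2 • q :=
    ((contDiff_const.inner ℝ contDiff_id).smul contDiff_id).sub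
      ((contDiff_norm_sq ℝ).smul contDiff_const)
  rw [integral_fderiv_apply hY hf hfc]
  congr 2 with y
  congr 1
  have h2 : HasFDerivAt (fun y => (inner ℝ q y : ℝ)) (innerSL ℝ q) y := (innerSL ℝ q).hasFDerivAt
  have hd := ((h2.smul (hasFDerivAt_id y)).sub
    ((hasStrictFDerivAt_norm_sq y).hasFDerivAt.smul_const q)).fderiv
  refine (Finset.sum_congr rfl fun i _ => congrArg
    (fun L : EuclideanSpace ℝ (Fin (n + 1)) →L[ℝ] EuclideanSpace ℝ (Fin (n + 1)) =>
      L (EuclideanSpace.single i 1) i) hd).trans ?_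
  refine (Finset.sum_congr rfl fun i _ => show _ = (inner ℝ q y : ℝ) +
      (innerSL ℝ q (EuclideanSpace.single i 1) * y i) -
      2 * (innerSL ℝ y (EuclideanSpace.single i 1) * q i) from ?_).trans ?_
  · simp
    ring
  rw [Finset.sum_sub_distrib, Finset.sum_add_distrib, Finset.sum_const, ← Finset.mul_sum,
    sum_apply_single_mul, sum_apply_single_mul]
  simp [real_inner_comm y q]
  ring

/-- The extension of `f` that is constant along rays restricts to `f` on the sphere, so the chain
rule expresses the intrinsic differential by an ambient derivative. -/
theorem mvfderiv_eq_fderiv_comp_sphProj (q : Sph n) {f : Sph n → ℝ}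
    (hf : ContMDiff (𝓡 n) 𝓘(ℝ, ℝ) 1 f) (x : Sph n) (v : TangentSpace (𝓡 n) x) :
    mvfderiv (𝓡 n) f x v = fderiv ℝ (fun y => f (sphProj q y)) x (dIncl n x v) := by
  have : Fact (Module.finrank ℝ (EuclideanSpace ℝ (Fin (n + 1))) = n + 1) :=
    ⟨finrank_euclideanSpace_fin⟩
  have hd := (contDiffAt_comp_sphProj q hf (ne_zero_of_mem_unit_sphere x)).differentiableAt
    one_ne_zero
  have hcomp := mfderiv_comp_apply (I' := 𝓘(ℝ, EuclideanSpace ℝ (Fin (n + 1)))) x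
    hd.mdifferentiableAt ((contMDiff_coe_sphere (m := 1) (n := n) x).mdifferentiableAt
      one_ne_zero) v
  have he : (fun y => f (sphProj q y)) ∘ (Subtype.val : Sph n → EuclideanSpace ℝ (Fin (n + 1))) =
      f := by
    ext y
    simp [sphProj_coe]
  rw [he, mfderiv_eq_fderiv] at hcomp
  exact hcomp

variable {q : Sph n} {V : ∀ x : Sph n, TangentSpace (𝓡 n) x}

theorem continuous_mvfderiv_apply_sphere
    (hV : ∀ x, dIncl n x (V x) = (inner ℝ (q : EuclideanSpace ℝ (Fin (n + 1))) x : ℝ) •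
      (x : EuclideanSpace ℝ (Fin (n + 1))) - q)
    {f : Sph n → ℝ} (hf : ContMDiff (𝓡 n) 𝓘(ℝ, ℝ) 1 f) :
    Continuous fun x => mvfderiv (𝓡 n) f x (V x) := by
  have h1 : ContinuousOn (fderiv ℝ fun y => f (sphProj q y)) {0}ᶜ := fun y hy =>
    ((contDiffAt_comp_sphProj q hf hy).continuousAt_fderiv one_ne_zero).continuousWithinAt
  have h2 : Continuous fun x : Sph n => fderiv ℝ (fun y => f (sphProj q y)) x :=
    h1.comp_continuous continuous_subtype_val fun x => ne_zero_of_mem_unit_sphere x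
  refine (h2.clm_apply (g := fun x : Sph n =>
    (inner ℝ (q : EuclideanSpace ℝ (Fin (n + 1))) x : ℝ) •
      (x : EuclideanSpace ℝ (Fin (n + 1))) - q) (by fun_prop)).congr fun x => ?_
  rw [mvfderiv_eq_fderiv_comp_sphProj q hf, hV]

/-- The Euclidean identity for the conformal field is applied to a radial cutoff times the extension
of `f` constant along rays. In polar coordinates both sides are an angular integral times the same
radial integral of `χ(r²) r`, which is nonzero and cancels. -/
theorem integral_mvfderiv_sphere
    (hV : ∀ x, dIncl n x (V x) = (inner ℝ (q : EuclideanSpace ℝ (Fin (n + 1))) x : ℝ) •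
      (x : EuclideanSpace ℝ (Fin (n + 1))) - q)
    {f : Sph n → ℝ} (hf : ContMDiff (𝓡 n) 𝓘(ℝ, ℝ) 1 f) :
    ∫ x, mvfderiv (𝓡 n) f x (V x)
        ∂(volume : Measure (EuclideanSpace ℝ (Fin (n + 1)))).toSphere =
      -∫ x, f x * (n * inner ℝ (q : EuclideanSpace ℝ (Fin (n + 1))) x)
        ∂(volume : Measure (EuclideanSpace ℝ (Fin (n + 1)))).toSphere := by
  -- The cutoff in `‖y‖²` vanishes near the origin, where `sphProj` is singular, and equals one on
  -- the unit sphere.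
  let χ : ContDiffBump (1 : ℝ) := ⟨1 / 4, 1 / 2, by norm_num, by norm_num⟩
  have hχ : ContDiff ℝ 1 χ := χ.contDiff (n := 1)
  have hχ2 : ContDiff ℝ 1 fun y : EuclideanSpace ℝ (Fin (n + 1)) => χ (‖y‖ ^ 2) :=
    hχ.comp (contDiff_norm_sq ℝ)
  have hχc : HasCompactSupport fun y : EuclideanSpace ℝ (Fin (n + 1)) => χ (‖y‖ ^ 2) := by
    refine HasCompactSupport.intro (isCompact_closedBall 0 2) fun y hy => ?_
    refine χ.zero_of_le_dist ?_
    rw [mem_closedBall_zero_iff, not_le] at hy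
    rw [Real.dist_eq, abs_of_nonneg (by nlinarith)]
    change 1 / 2 ≤ _
    nlinarith
  have hχ0 : (fun y : EuclideanSpace ℝ (Fin (n + 1)) => χ (‖y‖ ^ 2)) =ᶠ[𝓝 0] 0 := by
    have : Tendsto (fun y : EuclideanSpace ℝ (Fin (n + 1)) => ‖y‖ ^ 2) (𝓝 0) (𝓝 0) := by
      have h : Continuous fun y : EuclideanSpace ℝ (Fin (n + 1)) => ‖y‖ ^ 2 := by fun_prop
      simpa using h.tendsto 0
    filter_upwards [this.eventually (Iio_mem_nhds (by norm_num : (0 : ℝ) < 1 / 2))] with y hy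
    refine χ.zero_of_le_dist ?_
    have hy' : ‖y‖ ^ 2 < 1 / 2 := hy
    rw [Real.dist_eq, abs_sub_comm, abs_of_nonneg (by linarith)]
    change 1 / 2 ≤ _
    linarith
  let F : EuclideanSpace ℝ (Fin (n + 1)) → ℝ := fun y => χ (‖y‖ ^ 2) * f (sphProj q y)
  have hF : ContDiff ℝ 1 F := contDiff_iff_contDiffAt.2 fun y => by
    rcases eq_or_ne y 0 with rfl | hy
    · refine (contDiffAt_const (c := (0 : ℝ))).congr_of_eventuallyEq ?_
      filter_upwards [hχ0] with y hy
      simp [F, hy]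
    · exact hχ2.contDiffAt.mul (contDiffAt_comp_sphProj q hf hy)
  have hFc : HasCompactSupport F := hχc.mul_right
  have key := integral_fderiv_conformal (q : EuclideanSpace ℝ (Fin (n + 1))) hF hFc
  rw [integral_eq_toSphere_mul (a := fun x => mvfderiv (𝓡 n) f x (V x))
    (b := fun r => χ (r ^ 2) * r), integral_eq_toSphere_mul
    (a := fun x => f x * (n * inner ℝ (q : EuclideanSpace ℝ (Fin (n + 1))) x))
    (b := fun r => χ (r ^ 2) * r), ← neg_mul] at key
  · refine mul_right_cancel₀ ?_ key
    intro h0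
    -- The polar formula with constant angular part shows that a vanishing radial integral would
    -- make the integral of `χ(‖y‖²) ‖y‖` vanish. That integrand is continuous, nonnegative and
    -- nonzero at `q`.
    have h1 := integral_eq_toSphere_mul (n := n) (G := fun y => χ (‖y‖ ^ 2) * ‖y‖) (a := fun _ => 1)
      (b := fun r => χ (r ^ 2) * r) fun x r hr => by
        simp [norm_smul, abs_of_pos hr]
    rw [h0, mul_zero] at h1
    have h2 : 0 < ∫ y : EuclideanSpace ℝ (Fin (n + 1)), χ (‖y‖ ^ 2) * ‖y‖ :=
      Continuous.integral_pos_of_hasCompactSupport_nonneg_nonzero (x := (q : EuclideanSpace ℝ _))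
        (hχ2.continuous.mul continuous_norm) hχc.mul_right
        (fun y => mul_nonneg χ.nonneg (norm_nonneg y)) (by
          rw [norm_sph, one_pow, mul_one, χ.one_of_mem_closedBall
            (Metric.mem_closedBall_self χ.rIn_pos.le)]
          exact one_ne_zero)
    exact h2.ne' h1
  · intro x r hr
    simp only [F, sphProj_smul q hr, sphProj_coe, norm_smul, norm_sph, Real.norm_of_nonneg hr.le,
      inner_smul_right, mul_one]
    ring
  · intro x r hr
    set W := (inner ℝ (q : EuclideanSpace ℝ (Fin (n + 1))) x : ℝ) •
      (x : EuclideanSpace ℝ (Fin (n + 1))) - q with hW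
    have hy : r • (x : EuclideanSpace ℝ (Fin (n + 1))) ≠ 0 :=
      smul_ne_zero hr.ne' (ne_zero_of_mem_unit_sphere x)
    have e1 : (inner ℝ (q : EuclideanSpace ℝ (Fin (n + 1))) (r • (x : EuclideanSpace ℝ _)) : ℝ) •
        r • (x : EuclideanSpace ℝ (Fin (n + 1))) -
        ‖r • (x : EuclideanSpace ℝ (Fin (n + 1)))‖ ^ 2 • (q : EuclideanSpace ℝ _) = r ^ 2 • W := by
      rw [norm_smul, norm_sph, Real.norm_of_nonneg hr.le, inner_smul_right, hW, smul_sub, smul_smul,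
        smul_smul]
      ring_nf
    -- The field is tangent to the spheres, so the derivative of the radial cutoff along it is zero.
    have horth : (inner ℝ (x : EuclideanSpace ℝ (Fin (n + 1))) W : ℝ) = 0 := by
      rw [hW, inner_sub_right, inner_smul_right, real_inner_self_eq_norm_sq, norm_sph,
        real_inner_comm]
      ring
    have hsm : fderiv ℝ (fun y => f (sphProj q y)) (x : EuclideanSpace ℝ (Fin (n + 1))) =
        r • fderiv ℝ (fun y => f (sphProj q y)) (r • (x : EuclideanSpace ℝ (Fin (n + 1)))) := by
      rw [← fderiv_comp_smul]
      simp only [sphProj_smul q hr]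
    have hd1 : HasFDerivAt (fun y : EuclideanSpace ℝ (Fin (n + 1)) => χ (‖y‖ ^ 2)) _
        (r • (x : EuclideanSpace ℝ (Fin (n + 1)))) :=
      ((hχ.differentiable one_ne_zero _).hasDerivAt).comp_hasFDerivAt _
        (hasStrictFDerivAt_norm_sq _).hasFDerivAt
    have hd2 := ((contDiffAt_comp_sphProj q hf hy).differentiableAt one_ne_zero).hasFDerivAt
    have hd3 : HasFDerivAt F _ _ := hd1.mul hd2
    rw [e1, hd3.fderiv, mvfderiv_eq_fderiv_comp_sphProj q hf, hV, ← hW, hsm]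
    simp only [_root_.add_apply, _root_.smul_apply, map_smul, innerSL_apply_apply, smul_eq_mul,
      norm_smul, norm_sph, Real.norm_of_nonneg hr.le, horth, mul_one, nsmul_eq_mul]
    ring

end Sphere
-- Distance comparison and eigenvalue bound on the sphere
section Sphere

variable {n : ℕ} {c : ℝ} {q : Sph n}

/-- Minus the cosine of the angle to `q`. -/
noncomputable def sphNegCos (q x : Sph n) : ℝ :=
  -inner ℝ (q : EuclideanSpace ℝ (Fin (n + 1))) x

theorem sphNegCos_mem (q x : Sph n) : sphNegCos q x ∈ Icc (-1) 1 := by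
  have := abs_real_inner_le_norm (q : EuclideanSpace ℝ (Fin (n + 1))) x
  rw [norm_sph, norm_sph, one_mul] at this
  rwa [mem_Icc, ← abs_le, sphNegCos, abs_neg]

theorem exists_sphGrad (q x : Sph n) : ∃ v, dIncl n x v =
    (inner ℝ (q : EuclideanSpace ℝ (Fin (n + 1))) x : ℝ) •
      (x : EuclideanSpace ℝ (Fin (n + 1))) - q := by
  refine exists_dIncl_eq x ?_
  rw [inner_sub_right, inner_smul_right, real_inner_self_eq_norm_sq, norm_sph, real_inner_comm]
  ring

/-- The gradient of `sphNegCos q` for the metric of curvature `c`. -/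
noncomputable def sphGrad (c : ℝ) (q x : Sph n) : TangentSpace (𝓡 n) x :=
  c • (exists_sphGrad q x).choose

theorem contMDiff_sphNegCos (q : Sph n) : ContMDiff (𝓡 n) 𝓘(ℝ, ℝ) 1 (sphNegCos q) := by
  have : Fact (Module.finrank ℝ (EuclideanSpace ℝ (Fin (n + 1))) = n + 1) :=
    ⟨finrank_euclideanSpace_fin⟩
  have h : ContDiff ℝ 1 fun y : EuclideanSpace ℝ (Fin (n + 1)) =>
    -(inner ℝ (q : EuclideanSpace ℝ (Fin (n + 1))) y : ℝ) :=
    (contDiff_const.inner ℝ contDiff_id).neg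
  exact h.contMDiff.comp (contMDiff_coe_sphere (m := 1) (n := n))

theorem mvfderiv_sphNegCos (q x : Sph n) (v : TangentSpace (𝓡 n) x) :
    mvfderiv (𝓡 n) (sphNegCos q) x v =
      -inner ℝ (q : EuclideanSpace ℝ (Fin (n + 1))) (dIncl n x v) := by
  have : Fact (Module.finrank ℝ (EuclideanSpace ℝ (Fin (n + 1))) = n + 1) :=
    ⟨finrank_euclideanSpace_fin⟩
  have hd : HasFDerivAt (fun y : EuclideanSpace ℝ (Fin (n + 1)) =>
      -(inner ℝ (q : EuclideanSpace ℝ (Fin (n + 1))) y : ℝ))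
      (-innerSL ℝ (q : EuclideanSpace ℝ (Fin (n + 1)))) x := (innerSL ℝ _).hasFDerivAt.neg
  have hcomp := mfderiv_comp_apply (I' := 𝓘(ℝ, EuclideanSpace ℝ (Fin (n + 1)))) x
    hd.differentiableAt.mdifferentiableAt
    ((contMDiff_coe_sphere (m := 1) (n := n) x).mdifferentiableAt one_ne_zero) v
  rw [mfderiv_eq_fderiv, hd.fderiv] at hcomp
  exact hcomp

/-- The linear function `-⟨q, ·⟩` has ambient gradient `-q`, whose tangential part `⟨q, x⟩ x - q`
has squared length `1 - ⟨q, x⟩²`. Scaling the metric by `1/c` multiplies the gradient and its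
squared norm by `c`. -/
theorem isConformalGradient_sphNegCos (hc : 0 < c) (q : Sph n) :
    IsConformalGradient (sphMetric n c hc) (sphNegCos q) (sphGrad c q)
      fun t => c * (1 - t ^ 2) := by
  have key : ∀ x v, sphForm n c x (sphGrad c q x) v = inner ℝ
      ((inner ℝ (q : EuclideanSpace ℝ (Fin (n + 1))) x : ℝ) •
        (x : EuclideanSpace ℝ (Fin (n + 1))) - q) (dIncl n x v) := fun x v => by
    rw [sphForm_apply, sphGrad, map_smul, (exists_sphGrad q x).choose_spec,
      real_inner_smul_left, inv_mul_cancel_left₀ hc.ne']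
  refine ⟨contMDiff_sphNegCos q, fun x v => ?_, fun x => ?_⟩
  · rw [mvfderiv_sphNegCos]
    refine Eq.trans ?_ (key x v).symm
    rw [inner_sub_left, real_inner_smul_left, inner_dIncl]
    ring
  · refine (key x _).trans ?_
    rw [sphGrad, map_smul, (exists_sphGrad q x).choose_spec]
    simp only [inner_smul_right, inner_sub_right, inner_sub_left, real_inner_smul_left,
      real_inner_self_eq_norm_sq, norm_sph, sphNegCos]
    rw [real_inner_comm (q : EuclideanSpace ℝ (Fin (n + 1)))]
    ring

theorem hasDivergence_sphGrad (c : ℝ) (q : Sph n) :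
    HasDivergence (sphVolume n c) (sphGrad c q) fun x => n * (-c * sphNegCos q x) := by
  have hV := fun x => (exists_sphGrad q x).choose_spec
  refine ⟨fun f hf => ?_, ?_, fun f hf _ => ?_⟩
  · simp only [sphGrad, map_smul, smul_eq_mul]
    exact continuous_const.mul (continuous_mvfderiv_apply_sphere hV hf)
  · exact continuous_const.mul (continuous_const.mul (contMDiff_sphNegCos q).continuous)
  · simp only [sphGrad, map_smul, smul_eq_mul, sphVolume, integral_smul_measure]
    rw [integral_const_mul, integral_mvfderiv_sphere hV hf, ← mul_neg, ← integral_neg,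
      ← integral_neg, ← integral_const_mul]
    congr 2 with x
    simp only [sphNegCos]
    ring

/-- The function `G δ` is a primitive of `1 / √(c (1 - t²) + c δ)`. At `δ = 0` it is `arcsin t /
√c`, and for `t = -cos θ` with `0 ≤ θ ≤ π` the arcsine is `θ - π/2`. The positive `δ` keeps its
argument away from `±1`. -/
theorem sphNegCos_le_of_mem_geodesicBall (hc : 0 < c) {x : Sph n} {R : ℝ}
    (hR : 0 < R) (hR' : √c * R ≤ Real.pi / 2) (hx : x ∈ geodesicBall (sphMetric n c hc) q R) :
    sphNegCos q x ≤ -Real.cos (√c * R) := by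
  have hs : 0 < √c := Real.sqrt_pos.2 hc
  set G : ℝ → ℝ → ℝ := fun δ t => Real.arcsin (t / √(1 + δ)) / √c with hGdef
  have hlt : ∀ δ > 0, G δ (sphNegCos q x) - G δ (sphNegCos q q) < R := fun δ hδ => by
    have hδs : 0 < √(1 + δ) := Real.sqrt_pos.2 (by linarith)
    have hone : 1 < √(1 + δ) := by
      rw [Real.lt_sqrt zero_le_one]
      linarith
    have hneg : ∀ y, -1 < sphNegCos q y / √(1 + δ) := fun y => by
      rw [lt_div_iff₀ hδs]
      have := (sphNegCos_mem q y).1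
      linarith
    have hpos : ∀ y, sphNegCos q y / √(1 + δ) < 1 := fun y => by
      rw [div_lt_iff₀ hδs]
      have := (sphNegCos_mem q y).2
      linarith
    refine (isConformalGradient_sphNegCos hc q).sub_lt (δ := c * δ) (by positivity) (G := G δ)
      (fun y => ?_) (fun y => ?_) hx
    · have h1 : ContDiffAt ℝ 1 Real.arcsin (sphNegCos q y / √(1 + δ)) :=
        Real.contDiffAt_arcsin (hneg y).ne' (hpos y).ne
      exact (h1.comp (sphNegCos q y) (f := fun t => t / √(1 + δ))
        (contDiffAt_id.div_const _)).div_const _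
    · have h1 := ((Real.hasDerivAt_arcsin (hneg y).ne' (hpos y).ne).comp (sphNegCos q y)
        ((hasDerivAt_id (sphNegCos q y)).div_const (√(1 + δ)))).div_const (√c)
      convert! h1 using 1
      have e : c * (1 - sphNegCos q y ^ 2) + c * δ =
          c * ((1 + δ) * (1 - (sphNegCos q y / √(1 + δ)) ^ 2)) := by
        rw [div_pow, Real.sq_sqrt (by linarith)]
        field_simp
        ring
      rw [e, Real.sqrt_mul hc.le, Real.sqrt_mul (by linarith)]
      field_simp
  have hcont : ∀ y, Tendsto (fun δ => G δ (sphNegCos q y)) (𝓝[>] 0)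
      (𝓝 (G 0 (sphNegCos q y))) := fun y => by
    refine tendsto_nhdsWithin_of_tendsto_nhds ?_
    have h0 : √(1 + (0 : ℝ)) ≠ 0 := by simp
    have hs' : ContinuousAt (fun δ : ℝ => √(1 + δ)) 0 := by fun_prop
    have : ContinuousAt (fun δ => G δ (sphNegCos q y)) 0 :=
      (Real.continuous_arcsin.continuousAt.comp (continuousAt_const.div hs' h0)).div_const _
    exact this
  have hle : G 0 (sphNegCos q x) - G 0 (sphNegCos q q) ≤ R :=
    le_of_tendsto ((hcont x).sub (hcont q)) (by
      filter_upwards [self_mem_nhdsWithin] with δ hδ using (hlt δ hδ).le)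
  have hq : sphNegCos q q = -1 := by
    rw [sphNegCos, real_inner_self_eq_norm_sq, norm_sph]
    norm_num
  have h2 : Real.arcsin (sphNegCos q x) ≤ √c * R - Real.pi / 2 := by
    simp only [hGdef, add_zero, Real.sqrt_one, div_one, hq, Real.arcsin_neg, Real.arcsin_one]
      at hle
    rw [← sub_div, div_le_iff₀ hs] at hle
    linarith
  have hpi := Real.pi_pos
  have hsR : 0 < √c * R := by positivity
  have h3 := (Real.arcsin_le_iff_le_sin (sphNegCos_mem q x)
    ⟨by linarith, by linarith⟩).1 h2
  rwa [Real.sin_sub_pi_div_two] at h3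

theorem ofReal_le_lambdaOne_sphMetric (hn : 1 ≤ n) {p : ℝ} (hp : 1 < p) (hc : 0 < c) {R : ℝ}
    (hR : 0 < R) (hR' : √c * R ≤ Real.pi / 2) {Ω : Set (Sph n)}
    (hΩ : IsOpen Ω) (hsub : Ω ⊆ geodesicBall (sphMetric n c hc) q R) :
    ENNReal.ofReal ((((n : ℝ) - 1) * √c / p) ^ p * (Real.cot (√c * R)) ^ p) ≤
      lambdaOne (sphMetric n c hc) (sphVolume n c) p Ω := by
  have : IsFiniteMeasure (sphVolume n c) := Measure.smul_finite _ ENNReal.ofReal_ne_top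
  have hs : 0 < √c := Real.sqrt_pos.2 hc
  have hsR : 0 < √c * R := by positivity
  have hpi := Real.pi_pos
  have hsin := Real.sin_pos_of_pos_of_lt_pi hsR (by linarith)
  have hcos := Real.cos_nonneg_of_neg_pi_div_two_le_of_le (by linarith) hR'
  have hcs := Real.sin_sq_add_cos_sq (√c * R)
  have hn' : (1 : ℝ) ≤ n := by exact_mod_cast hn
  have hA : c * (1 - (-Real.cos (√c * R)) ^ 2) = (√c * Real.sin (√c * R)) ^ 2 := by
    rw [mul_pow, Real.sq_sqrt hc.le, ← hcs]
    ring
  have key := (isConformalGradient_sphNegCos hc q).ofReal_le_lambdaOne_of_mono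
    (H := fun t => -c * t) (hasDivergence_sphGrad c q) (by fun_prop)
    (fun t => by
      convert! ((hasDerivAt_pow 2 t).const_sub 1).const_mul c using 1
      push_cast
      ring) (by fun_prop) hp hn
    (t := -Real.cos (√c * R)) (by rw [hA]; positivity)
    (by rw [neg_mul_neg]; positivity) hΩ.measurableSet ?_
  · refine le_trans (le_of_eq ?_) key
    rw [hA, Real.sqrt_sq (by positivity), Real.cot_eq_cos_div_sin, ← Real.mul_rpow
      (div_nonneg (mul_nonneg (by linarith) hs.le) (by linarith)) (by positivity)]
    have h1 : √c * √c = c := Real.mul_self_sqrt hc.le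
    have h2 : -c * -Real.cos (√c * R) / (√c * Real.sin (√c * R)) =
        √c * (Real.cos (√c * R) / Real.sin (√c * R)) := by
      rw [div_eq_iff (by positivity), mul_mul_mul_comm, h1, div_mul_cancel₀ _ hsin.ne', neg_mul_neg]
    rw [h2]
    congr 2
    ring
  · filter_upwards [self_mem_nhdsWithin] with δ hδ x hx
    have hδ' : 0 < δ := hδ
    have h1 := sphNegCos_mem q x
    have h2 := sphNegCos_le_of_mem_geodesicBall hc hR hR' (hsub hx)
    -- On the closed hemisphere `t = sphNegCos q x` is nonpositive, because `√c R ≤ π/2`. As `t`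
    -- increases to `-cos(√c R)`, the numerator `-c t` decreases and the denominator `√(c (1 - t²) +
    -- δ)` increases.
    have h3 : (-Real.cos (√c * R)) ^ 2 ≤ sphNegCos q x ^ 2 := by
      rw [neg_sq, ← neg_sq (sphNegCos q x)]
      have : Real.cos (√c * R) ≤ -sphNegCos q x := by linarith
      gcongr
    have h4 : 0 ≤ c * (1 - sphNegCos q x ^ 2) :=
      (isConformalGradient_sphNegCos hc q).nonneg x
    have h5 : 0 ≤ -c * sphNegCos q x := by nlinarith
    refine div_le_div₀ h5 (by nlinarith) (Real.sqrt_pos.2 (by linarith)) (Real.sqrt_le_sqrt ?_)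
    nlinarith

end Sphere
end SpaceForm

/-! ### The three space forms together -/

open SpaceForm in
theorem corollary3 (n : ℕ) (hn : 2 ≤ n) (p : ℝ) (hp : 1 < p) (c R : ℝ) (hR : 0 < R) :
    (∀ hc : c < 0, ∀ (q : EuclideanSpace ℝ (Fin n)) (Ω : Set (EuclideanSpace ℝ (Fin n))),
      IsOpen Ω → IsConnected Ω → Ω ⊆ geodesicBall (hypMetric n c hc) q R →
        ENNReal.ofReal ((((n : ℝ) - 1) * √(-c) / p) ^ p *
            (Real.cosh (√(-c) * R) / Real.sinh (√(-c) * R)) ^ p) ≤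
          lambdaOne (hypMetric n c hc) (hypVolume n c) p Ω) ∧
    (c = 0 → ∀ (q : EuclideanSpace ℝ (Fin n)) (Ω : Set (EuclideanSpace ℝ (Fin n))),
      IsOpen Ω → IsConnected Ω → Ω ⊆ geodesicBall (euclideanMetric n) q R →
        ENNReal.ofReal (((n : ℝ) - 1) ^ p / (p ^ p * R ^ p)) ≤
          lambdaOne (euclideanMetric n) volume p Ω) ∧
    (∀ hc : 0 < c, √c * R ≤ Real.pi / 2 → ∀ (q : Sph n) (Ω : Set (Sph n)),
      IsOpen Ω → IsConnected Ω → Ω ⊆ geodesicBall (sphMetric n c hc) q R →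
        ENNReal.ofReal ((((n : ℝ) - 1) * √c / p) ^ p * (Real.cot (√c * R)) ^ p) ≤
          lambdaOne (sphMetric n c hc) (sphVolume n c) p Ω) := by
  have hn' : 1 ≤ n := by omega
  exact ⟨fun hc q Ω hΩ _ hsub => ofReal_le_lambdaOne_hypMetric hn' hp hc hR hΩ hsub,
    fun _ q Ω hΩ _ hsub => ofReal_le_lambdaOne_euclideanMetric hn' hp hR hΩ hsub,
    fun hc hR' q Ω hΩ _ hsub => ofReal_le_lambdaOne_sphMetric hn' hp hc hR hR' hΩ hsub⟩
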